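/- Let $G$ be a compact connected Lie group, $\theta$ an involutive automorphism of $G$, and $K\subset G$ a closed subgroup with $G_\theta^0\subset K\subset G_\theta$, where $G_\theta=\{g\in G\mid\theta(g)=g\}$ and $G_\theta^0$ is its identity component. Let $\langle\,,\,\rangle$ be an inner product on the Lie algebra $\mathfrak g$ of $G$ invariant under $\theta$ and $\mathrm{Ad}(G)$, put $\mathfrak m=\{X\in\mathfrak g\mid\theta(X)=-X\}$, and assume that the symmetric pair $(G,K)$ is irreducible, i.e. that $K$ acts irreducibly on $\mathfrak m\neq\{0\}$ by $\mathrm{Ad}$. Let $\mathfrak a$ be a maximal Abelian subspace of $\mathfrak m$ and let $\alpha$ be a restricted root: $\alpha\in\mathfrak a\setminus\{0\}$, and there is $0\ne X\in\mathfrak g^{\mathbf C}$ with $[H,X]=\sqrt{-1}\langle\alpha,H\rangle X$ for all $H\in\mathfrak a$. Let $S$ be the hypersphere of $\mathfrak m$ with center $0$ and radius $\|\alpha\|$, and put $N_K=\{k\in K\mid\mathrm{Ad}(k)\mathfrak a=\mathfrak a\}$ and $s_\alpha(X)=X-\frac{2\langle\alpha,X\rangle}{\langle\alpha,\alpha\rangle}\alpha$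 for $X\in\mathfrak a$. For a submanifold $M$ of a Riemannian manifold $\tilde M$, a reflection of $M$ with respect to a normal vector $\xi\in T_x^\perp M$ is an isometry $\sigma$ of $\tilde M$ with $\sigma(x)=x$, $(d\sigma)_x\xi=-\xi$ and $\sigma(M)=M$; $M$ is called weakly reflective if it has a reflection with respect to every normal vector at every point. Then: 1. the orbit $M=\mathrm{Ad}(K)\alpha$ is a weakly reflective (embedded) submanifold of $S$; 2. there is $k_0\in N_K$ with $\mathrm{Ad}(k_0)|_{\mathfrak a}=s_\alpha$; 3. for every such $k_0$, the map $\sigma=-\mathrm{Ad}(k_0)$ restricts to a bijection of $S$, and every $\xi\in\mathfrak a$ with $\langle\alpha,\xi\rangle=0$ is normal to $M$ in $S$ at $\alpha$ and $\sigma$ is a reflection of $M$ at $\alpha$ with respect to $\xi$; moreover, for every normal vector $\xi$ of $M$ in $S$ at $\alpha$ there is $k_1\in K$ with $\mathrm{Ad}(k_1)\alpha=\alpha$ and $\mathrm{Ad}(k_1)\xi\in\mathfrak a$ such that $\mathrm{Ad}(k_1)^{-1}\circ\sigma\circ\mathrm{Ad}(k_1)$ is a reflection of $M$ at $\alpha$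 with respect to $\xi$. -/

import Mathlib

open scoped Manifold ContDiff TensorProduct

noncomputable section

namespace SRep

section Submanifolds

/-! Submanifolds of a finite-dimensional real vector space `V`. The Riemannian metric of a
submanifold is the one induced by an inner product `B` on `V`. -/

variable {V : Type*} [NormedAddCommGroup V] [NormedSpace ℝ V]

/-- `M` is a (smooth, embedded) submanifold of `V`: near each of its points it is flattened onto a
fixed linear subspace `W` by a local diffeomorphism of `V`. An embedded submanifold of `V` that is
contained in an embedded submanifold `S` of `V` is an embedded submanifold of `S`. -/
def IsEmbeddedSubmanifold (M : Set V) : Prop :=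
  ∃ W : Submodule ℝ V, ∀ x ∈ M, ∃ φ : OpenPartialHomeomorph V V,
    x ∈ φ.source ∧ ContDiffOn ℝ ∞ φ φ.source ∧ ContDiffOn ℝ ∞ φ.symm φ.target ∧
    φ '' (φ.source ∩ M) = φ.target ∩ (W : Set V)

/-- A smooth curve in the submanifold `M`. -/
def IsSmoothCurve {M : Set V} (c : ℝ → M) : Prop :=
  ContDiff ℝ ∞ (fun t => (c t : V))

/-- The velocity vector of a curve in `M`. -/
def velocity {M : Set V} (c : ℝ → M) (t : ℝ) : V :=
  deriv (fun s => (c s : V)) t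

/-- The tangent space `T_x M` of a submanifold: the velocities of smooth curves in `M`. -/
def tangentVectors (M : Set V) (x : V) : Set V :=
  {v | ∃ c : ℝ → M, IsSmoothCurve c ∧ (c 0 : V) = x ∧ velocity c 0 = v}

/-- The normal space `T_x^⊥ M` of a submanifold `M` of the Riemannian manifold `S ⊆ V`. -/
def normalVectors (B : LinearMap.BilinForm ℝ V) (S M : Set V) (x : V) : Set V :=
  {ξ | ξ ∈ tangentVectors S x ∧ ∀ v ∈ tangentVectors M x, B v ξ = 0}

/-- `σ` is an isometry of the Riemannian manifold `S ⊆ V`: a diffeomorphism of `S` that preserves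
the lengths of tangent vectors. (A map of manifolds is smooth if and only if it maps smooth curves
to smooth curves, and its differential maps the velocity of `c` to the velocity of `σ ∘ c`.) -/
structure IsRiemannianIsometry (B : LinearMap.BilinForm ℝ V) {S : Set V}
    (σ : Equiv.Perm S) : Prop where
  smooth : ∀ c : ℝ → S, IsSmoothCurve c → IsSmoothCurve (fun t => σ (c t))
  smooth_symm : ∀ c : ℝ → S, IsSmoothCurve c → IsSmoothCurve (fun t => σ.symm (c t))
  speed : ∀ c : ℝ → S, IsSmoothCurve c → ∀ t : ℝ,
    B (velocity (fun s => σ (c s)) t) (velocity (fun s => σ (c s)) t) =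
      B (velocity c t) (velocity c t)

/-- `σ` is a reflection of the submanifold `M` of `S` at the point `x` with respect to the normal
vector `ξ`: an isometry of `S` with `σ x = x`, `(dσ)_x ξ = - ξ` and `σ M = M`. -/
structure IsReflection (B : LinearMap.BilinForm ℝ V) {S : Set V} (M : Set V) (x : S) (ξ : V)
    (σ : Equiv.Perm S) : Prop where
  isometry : IsRiemannianIsometry B σ
  fixes : σ x = x
  differential : ∀ c : ℝ → S, IsSmoothCurve c → c 0 = x → velocity c 0 = ξ →
    velocity (fun t => σ (c t)) 0 = -ξ
  image : σ '' {y : S | (y : V) ∈ M} = {y : S | (y : V) ∈ M}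

/-- `M` is a weakly reflective submanifold of the Riemannian manifold `S`, where `S` is a
submanifold of `V` with the metric induced by the inner product `B`. -/
structure IsWeaklyReflective (B : LinearMap.BilinForm ℝ V) (S M : Set V) : Prop where
  subset : M ⊆ S
  submanifold : IsEmbeddedSubmanifold M
  reflection : ∀ x : S, (x : V) ∈ M → ∀ ξ ∈ normalVectors B S M x,
    ∃ σ : Equiv.Perm S, IsReflection B M x ξ σ

end Submanifolds

section LieGroups

variable {E : Type*} [NormedAddCommGroup E] [NormedSpace ℝ E]
  {G : Type*} [TopologicalSpace G] [ChartedSpace E G] [Group G]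

variable (E G) in
/-- The Lie algebra `𝔤 = T_1 G` of a Lie group modelled on `E`. -/
abbrev LieAlg : Type _ := GroupLieAlgebra 𝓘(ℝ, E) G

/-- Mathlib's tangent spaces carry only the topology of the model space; this is a norm inducing
it. -/
instance instNormedAddCommGroupLieAlg : NormedAddCommGroup (LieAlg E G) :=
  inferInstanceAs (NormedAddCommGroup E)

instance instNormedSpaceLieAlg : NormedSpace ℝ (LieAlg E G) :=
  inferInstanceAs (NormedSpace ℝ E)

instance instFiniteDimensionalLieAlg [FiniteDimensional ℝ E] :
    FiniteDimensional ℝ (LieAlg E G) :=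
  inferInstanceAs (FiniteDimensional ℝ E)

instance instLieGroupMinSmoothness [LieGroup 𝓘(ℝ, E) ∞ G] :
    LieGroup 𝓘(ℝ, E) (minSmoothness ℝ 3) G :=
  LieGroup.of_le (n := ∞) (by rw [minSmoothness_of_isRCLikeNormedField]; exact ENat.LEInfty.out)

/-- The differential at `1` of a map `f : G → G` with `f 1 = 1`, as an endomorphism of `𝔤`. -/
def diffOne (f : G → G) : LieAlg E G →L[ℝ] LieAlg E G :=
  mfderiv 𝓘(ℝ, E) 𝓘(ℝ, E) f (1 : G)

/-- The adjoint representation of `G`. -/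
def Ad (g : G) : LieAlg E G →L[ℝ] LieAlg E G :=
  diffOne (fun x : G => g * x * g⁻¹)

variable (E) in
/-- `(G, K)` is a symmetric pair with respect to the involutive automorphism `θ` of `G`:
`K` is a closed subgroup with `(G_θ)⁰ ⊆ K ⊆ G_θ`. -/
structure IsSymmetricPair (θ : G →* G) (K : Subgroup G) : Prop where
  smooth : ContMDiff 𝓘(ℝ, E) 𝓘(ℝ, E) ∞ θ
  involutive : Function.Involutive θ
  closed : IsClosed (K : Set G)
  identityComponent_le : connectedComponentIn {g : G | θ g = g} 1 ⊆ (K : Set G)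
  le_fixed : ∀ k ∈ K, θ k = k

/-- `B` is an inner product on `𝔤` invariant under `θ` and the adjoint representation of `G`. -/
structure IsInvariantInnerProduct (θ : G →* G) (B : LinearMap.BilinForm ℝ (LieAlg E G)) :
    Prop where
  symm : ∀ X Y, B X Y = B Y X
  pos : ∀ X, X ≠ 0 → 0 < B X X
  ad_invariant : ∀ (g : G) (X Y : LieAlg E G), B (Ad g X) (Ad g Y) = B X Y
  theta_invariant : ∀ X Y : LieAlg E G, B (diffOne θ X) (diffOne θ Y) = B X Y

/-- The `-1`-eigenspace `𝔪` of (the differential of) `θ` in `𝔤`. -/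
def mSpace (θ : G →* G) : Submodule ℝ (LieAlg E G) where
  carrier := {X | diffOne θ X = -X}
  zero_mem' := by simp
  add_mem' := fun {X Y} hX hY => by
    simp only [Set.mem_ofPred_eq] at hX hY ⊢
    rw [map_add, hX, hY, neg_add]
  smul_mem' := fun c X hX => by
    simp only [Set.mem_ofPred_eq] at hX ⊢
    rw [map_smul, hX, smul_neg]

variable (E) in
/-- The symmetric pair is irreducible: `K` acts irreducibly on `𝔪`. -/
def IsIrreduciblePair (θ : G →* G) (K : Subgroup G) : Prop :=
  (mSpace θ : Submodule ℝ (LieAlg E G)) ≠ ⊥ ∧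
    ∀ W : Submodule ℝ (LieAlg E G), W ≤ mSpace θ → (∀ k ∈ K, ∀ X ∈ W, Ad k X ∈ W) →
      W = ⊥ ∨ W = mSpace θ

/-- `𝔞` is a maximal Abelian subspace of `𝔪`. -/
def IsMaximalAbelian (θ : G →* G) (a : Submodule ℝ (LieAlg E G)) : Prop :=
  Maximal (fun b : Submodule ℝ (LieAlg E G) => b ≤ mSpace θ ∧ ∀ X ∈ b, ∀ Y ∈ b, ⁅X, Y⁆ = 0) a

/-- `α` belongs to the restricted root system `R` with respect to `𝔞`: `α ∈ 𝔞`, `α ≠ 0`, and there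
is `X ≠ 0` in the complexification of `𝔤` with `[H, X] = √-1 ⟨α, H⟩ X` for all `H ∈ 𝔞`. -/
def IsRestrictedRoot [FiniteDimensional ℝ E] [LieGroup 𝓘(ℝ, E) ∞ G]
    (B : LinearMap.BilinForm ℝ (LieAlg E G)) (a : Submodule ℝ (LieAlg E G))
    (α : LieAlg E G) : Prop :=
  α ∈ a ∧ α ≠ 0 ∧ ∃ X : ℂ ⊗[ℝ] LieAlg E G, X ≠ 0 ∧
    ∀ H ∈ a, ⁅(1 : ℂ) ⊗ₜ[ℝ] H, X⁆ = (Complex.I * (B α H : ℂ)) • X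

/-- The reflection `s_α X = X - (2⟨α, X⟩ / ⟨α, α⟩) α`. -/
def rootReflection (B : LinearMap.BilinForm ℝ (LieAlg E G)) (α X : LieAlg E G) : LieAlg E G :=
  X - (2 * B α X / B α α) • α

/-- The set `N_K = {k ∈ K | Ad(k) 𝔞 = 𝔞}`. -/
def normalizerIn (K : Subgroup G) (a : Submodule ℝ (LieAlg E G)) : Set G :=
  {k | k ∈ K ∧ Ad k '' (a : Set (LieAlg E G)) = a}

/-- The orbit `Ad(K) H` of the linear isotropy representation. -/
def orbit (K : Subgroup G) (H : LieAlg E G) : Set (LieAlg E G) :=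
  {X | ∃ k ∈ K, X = Ad k H}

/-- The hypersphere of `𝔪` with center `0` and radius `‖H‖`. -/
def hypersphere (θ : G →* G) (B : LinearMap.BilinForm ℝ (LieAlg E G)) (H : LieAlg E G) :
    Set (LieAlg E G) :=
  {X | X ∈ mSpace θ ∧ B X X = B H H}

end LieGroups

end SRep

end

noncomputable section

open Set Filter Topology VectorField

namespace SRep

/-! ### Smoothness of `Ad` and its derivative at the identity. -/

section AdjointRepresentation

set_option linter.unusedSectionVars false

variable {E : Type*} [NormedAddCommGroup E] [NormedSpace ℝ E]
  {G : Type*} [TopologicalSpace G] [ChartedSpace E G] [Group G] [LieGroup 𝓘(ℝ, E) ∞ G]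

/-! A root vector splits into `Z` fixed by θ and `Y` in 𝔪, with [H, Z] = ⟨α, H⟩Y and [H, Y] = -⟨α,
H⟩Z for H in 𝔞. Maximality of 𝔞 gives [Z, Y] = |Z|²α, so ad Z rotates the plane of α and Y and kills
𝔞 ∩ α^⊥; half a turn is an element of K inducing s_α (`exists_Ad_eq_reflection`). For any such k₀,
the map -Ad(k₀) fixes α, negates 𝔞 ∩ α^⊥, and preserves the orbit because -α = Ad(k₀)α lies in it.

The normal vectors at α are the vectors of 𝔪 orthogonal to α and commuting with it
(`mem_normalVectors_iff`). The stabilizer of α in K moves each of them into 𝔞 (`exists_Ad_mem`):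
maximizing ⟨Ad(k)ξ, H⟩ over a compact group forces [Ad(k)ξ, H] = 0. Conjugates of -Ad(k₀) therefore
serve all normal vectors at α, and homogeneity serves the other points.

For embeddedness, the slice map v ↦ exp(ad Lv)(α + v - Pv) reduces the claim to the isolation of α
among the orbit points commuting with it (`exists_forall_norm_lt_eq_zero`). If α + ξ is such a
point, ad(α + ξ) commutes with ad α and is conjugate to it, so ad ξ is annihilated by a polynomial
depending only on α. For small ξ this makes ad ξ nilpotent; being skew it vanishes, and
irreducibility keeps the centre away from 𝔪.

The Lie theory needed is that the derivative of Ad at 1 is the bracket (`lie_eq_fderiv_AdE`), and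
that one-parameter subgroups with θ-fixed velocity stay in K and act by exp(ad Z)
(`exists_AdE_eq_exp`). The rest is linear algebra and calculus on `IsotropyData` and `RootData`. -/

theorem contMDiff_conj :
    ContMDiff (𝓘(ℝ, E).prod 𝓘(ℝ, E)) 𝓘(ℝ, E) ∞ (fun p : G × G => p.1 * p.2 * p.1⁻¹) :=
  (contMDiff_fst.mul contMDiff_snd).mul contMDiff_fst.inv

theorem contMDiff_conj_right (g : G) :
    ContMDiff 𝓘(ℝ, E) 𝓘(ℝ, E) ∞ (fun x : G => g * x * g⁻¹) :=
  (contMDiff_const.mul contMDiff_id).mul contMDiff_const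

theorem mdifferentiableAt_conj (g x : G) :
    MDifferentiableAt 𝓘(ℝ, E) 𝓘(ℝ, E) (fun x : G => g * x * g⁻¹) x :=
  (contMDiff_conj_right g).mdifferentiableAt (by simp)

theorem diffOne_comp {f f' : G → G} (hf : MDifferentiableAt 𝓘(ℝ, E) 𝓘(ℝ, E) f 1)
    (hf' : MDifferentiableAt 𝓘(ℝ, E) 𝓘(ℝ, E) f' 1) (h1 : f' 1 = 1) :
    (diffOne (f ∘ f') : LieAlg E G →L[ℝ] LieAlg E G) = (diffOne f).comp (diffOne f') := by
  have h := mfderiv_comp (I := 𝓘(ℝ, E)) (I' := 𝓘(ℝ, E)) (I'' := 𝓘(ℝ, E)) (1 : G)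
    (g := f) (f := f') (by rwa [h1]) hf'
  rw [h1] at h
  exact h

theorem Ad_one : (Ad (1 : G) : LieAlg E G →L[ℝ] LieAlg E G) = 1 := by
  have : (fun x : G => 1 * x * 1⁻¹) = id := by ext; simp
  rw [Ad, this]
  exact mfderiv_id

theorem Ad_mul (g h : G) :
    (Ad (g * h) : LieAlg E G →L[ℝ] LieAlg E G) = (Ad g).comp (Ad h) := by
  rw [Ad, Ad, Ad, ← diffOne_comp (mdifferentiableAt_conj g 1) (mdifferentiableAt_conj h 1) (by simp)]
  congr 1
  ext x
  simp [mul_assoc]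

/-- The adjoint representation as a map into a normed space. -/
def AdE (g : G) : E →L[ℝ] E := (Ad g : LieAlg E G →L[ℝ] LieAlg E G)

/-- Joint smoothness of conjugation makes its partial derivative smooth in tangent coordinates. All
conjugations fix 1, so these coordinates compare the chart at 1 with itself and drop out. -/
theorem contMDiff_AdE : ContMDiff 𝓘(ℝ, E) 𝓘(ℝ, E →L[ℝ] E) ∞ (AdE : G → E →L[ℝ] E) := by
  intro g
  have h := ContMDiffAt.mfderiv (I := 𝓘(ℝ, E)) (I' := 𝓘(ℝ, E)) (J := 𝓘(ℝ, E)) (n := ∞) (m := ∞) (x₀ := g)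
    (fun g x : G => g * x * g⁻¹) (fun _ : G => (1 : G)) (contMDiff_conj.contMDiffAt)
    contMDiffAt_const (by simp)
  have : IsManifold 𝓘(ℝ, E) 1 G := IsManifold.of_le (n := ∞) (by simp)
  refine h.congr_of_eventuallyEq (Filter.Eventually.of_forall fun x => ?_)
  have e : ∀ y : G, y * 1 * y⁻¹ = 1 := fun y => by simp
  have h2 := inTangentCoordinates_eq (I := 𝓘(ℝ, E)) (I' := 𝓘(ℝ, E)) (fun _ : G => (1 : G))
    (fun x : G => x * 1 * x⁻¹) (fun x => AdE x) (x₀ := g) (x := x) (by simp) (by simp)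
  have h1 : ∀ w, (tangentBundleCore 𝓘(ℝ, E) G).coordChange (achart E (1 : G)) (achart E (1 : G)) 1 w
      = w := fun w => (tangentBundleCore 𝓘(ℝ, E) G).coordChange_self _ _ (by simp) _
  refine Eq.trans ?_ h2.symm
  simp only [e]
  ext v
  simp only [ContinuousLinearMap.comp_apply]
  rw [h1]
  exact congrArg (AdE x) (h1 v).symm

theorem contMDiffAt_symm_chart :
    ContMDiffAt 𝓘(ℝ, E) 𝓘(ℝ, E) ∞ (extChartAt 𝓘(ℝ, E) (1 : G)).symm
      (extChartAt 𝓘(ℝ, E) (1 : G) 1) := by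
  have := contMDiffWithinAt_extChartAt_symm_range_self (I := 𝓘(ℝ, E)) (n := ∞) (1 : G)
  rwa [ModelWithCorners.range_eq_univ, contMDiffWithinAt_univ] at this

theorem contDiffAt_AdE_symm_chart :
    ContDiffAt ℝ ∞ (fun x : E => (AdE ((extChartAt 𝓘(ℝ, E) (1 : G)).symm x) : E →L[ℝ] E))
      (extChartAt 𝓘(ℝ, E) (1 : G) 1) :=
  (ContMDiffAt.comp (g := (AdE : G → E →L[ℝ] E)) _ contMDiff_AdE.contMDiffAt
    contMDiffAt_symm_chart).contDiffAt

theorem hasMFDerivAt_chart_of_eq_one (g : G) (hg : g = 1) :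
    HasMFDerivAt 𝓘(ℝ, E) 𝓘(ℝ, E) (extChartAt 𝓘(ℝ, E) (1 : G)) g (ContinuousLinearMap.id ℝ E) := by
  subst hg
  have : IsManifold 𝓘(ℝ, E) 1 G := IsManifold.of_le (n := ∞) (by simp)
  have h := (mdifferentiableAt_extChartAt (I := 𝓘(ℝ, E)) (x := (1 : G)) (y := 1)
    (by simp)).hasMFDerivAt
  rwa [mfderiv_extChartAt_self] at h

theorem hasMFDerivAt_symm_chart :
    HasMFDerivAt 𝓘(ℝ, E) 𝓘(ℝ, E) (extChartAt 𝓘(ℝ, E) (1 : G)).symm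
      (extChartAt 𝓘(ℝ, E) (1 : G) 1) (ContinuousLinearMap.id ℝ E) := by
  have : IsManifold 𝓘(ℝ, E) 1 G := IsManifold.of_le (n := ∞) (by simp)
  have h := (contMDiffAt_symm_chart.mdifferentiableAt (by simp :
    (∞ : WithTop ℕ∞) ≠ 0)).hasMFDerivAt (M := E) (M' := G) (I := 𝓘(ℝ, E)) (I' := 𝓘(ℝ, E))
  have h2 := mfderivWithin_range_extChartAt_symm (I := 𝓘(ℝ, E)) (x := (1 : G))
  rw [ModelWithCorners.range_eq_univ, mfderivWithin_univ] at h2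
  rwa [h2] at h

/-- Multiplication in the chart at `1`. -/
def chartMul (G : Type*) [TopologicalSpace G] [ChartedSpace E G] [Group G] (p : E × E) : E :=
  extChartAt 𝓘(ℝ, E) (1 : G)
    ((extChartAt 𝓘(ℝ, E) (1 : G)).symm p.1 * (extChartAt 𝓘(ℝ, E) (1 : G)).symm p.2)

theorem contDiffAt_chartMul :
    ContDiffAt ℝ ∞ (chartMul G : E × E → E)
      (extChartAt 𝓘(ℝ, E) (1 : G) 1, extChartAt 𝓘(ℝ, E) (1 : G) 1) := by
  set φ := extChartAt 𝓘(ℝ, E) (1 : G) with hφ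
  have h : ContMDiffAt 𝓘(ℝ, E) 𝓘(ℝ, E) ∞ φ.symm (φ 1) := contMDiffAt_symm_chart
  have h1 : ContMDiffAt 𝓘(ℝ, E × E) 𝓘(ℝ, E) ∞ (fun p : E × E => φ.symm p.1) (φ 1, φ 1) :=
    ContMDiffAt.comp (g := φ.symm) (f := Prod.fst) (φ 1, φ 1) h contDiff_fst.contMDiff.contMDiffAt
  have h2 : ContMDiffAt 𝓘(ℝ, E × E) 𝓘(ℝ, E) ∞ (fun p : E × E => φ.symm p.2) (φ 1, φ 1) :=
    ContMDiffAt.comp (g := φ.symm) (f := Prod.snd) (φ 1, φ 1) h contDiff_snd.contMDiff.contMDiffAt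
  have h3 := h1.mul h2
  have h4 : ContMDiffAt 𝓘(ℝ, E) 𝓘(ℝ, E) ∞ φ (φ.symm (φ 1) * φ.symm (φ 1)) := by
    have : φ.symm (φ 1) * φ.symm (φ 1) = 1 := by simp [hφ]
    rw [this]
    exact contMDiffAt_extChartAt
  exact (ContMDiffAt.comp (g := φ) (φ 1, φ 1) h4 h3).contDiffAt

theorem fderiv_chartMul_symm (X Y : E × E) :
    fderiv ℝ (fderiv ℝ (chartMul G : E × E → E))
      (extChartAt 𝓘(ℝ, E) (1 : G) 1, extChartAt 𝓘(ℝ, E) (1 : G) 1) X Y =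
    fderiv ℝ (fderiv ℝ (chartMul G : E × E → E))
      (extChartAt 𝓘(ℝ, E) (1 : G) 1, extChartAt 𝓘(ℝ, E) (1 : G) 1) Y X := by
  have h := (contDiffAt_chartMul (E := E) (G := G)).isSymmSndFDerivAt (by
    simp only [minSmoothness_of_isRCLikeNormedField]; exact ENat.LEInfty.out)
  exact h.eq X Y

theorem eventually_differentiableAt_chartMul :
    ∀ᶠ p in 𝓝 (extChartAt 𝓘(ℝ, E) (1 : G) 1, extChartAt 𝓘(ℝ, E) (1 : G) 1),
      DifferentiableAt ℝ (chartMul G : E × E → E) p := by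
  filter_upwards [(contDiffAt_chartMul.of_le (by simp : (1 : WithTop ℕ∞) ≤ ∞)).eventually
    (by simp)] with p hp using hp.differentiableAt (by simp)

/-- The tangent spaces depend on the base point. Typing the derivative over the model space `E` lets
equal base points be exchanged. -/
theorem hasMFDerivAt_congr_point {f : G → G} {p q : G} {L : E →L[ℝ] E} (h : p = q)
    (hf : HasMFDerivAt 𝓘(ℝ, E) 𝓘(ℝ, E) f q L) : HasMFDerivAt 𝓘(ℝ, E) 𝓘(ℝ, E) f p L := by
  subst h; exact hf

theorem hasMFDerivAt_congr_point' {f : G → E} {p q : G} {L : E →L[ℝ] E} (h : p = q)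
    (hf : HasMFDerivAt 𝓘(ℝ, E) 𝓘(ℝ, E) f q L) : HasMFDerivAt 𝓘(ℝ, E) 𝓘(ℝ, E) f p L := by
  subst h; exact hf

/-- The left-invariant fields in the chart at `1`. -/
def chartField (Y : LieAlg E G) (x : E) : E :=
  mpullbackWithin 𝓘(ℝ, E) 𝓘(ℝ, E) (extChartAt 𝓘(ℝ, E) (1 : G)).symm
      (mulInvariantVectorField Y) univ x

/-- The pullback inverts the differential of the inverse chart, which gives the differential of the
chart; the chain rule for left translation does the rest. -/
theorem chartField_eventuallyEq (Y : LieAlg E G) :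
    chartField Y =ᶠ[𝓝 (extChartAt 𝓘(ℝ, E) (1 : G) 1)]
    fun x => fderiv ℝ (chartMul G) (x, extChartAt 𝓘(ℝ, E) (1 : G) 1) ((0 : E), Y) := by
  have : IsManifold 𝓘(ℝ, E) 1 G := IsManifold.of_le (n := ∞) (by simp)
  have hc : Tendsto (fun x : E => (x, extChartAt 𝓘(ℝ, E) (1 : G) 1))
      (𝓝 (extChartAt 𝓘(ℝ, E) (1 : G) 1))
      (𝓝 (extChartAt 𝓘(ℝ, E) (1 : G) 1, extChartAt 𝓘(ℝ, E) (1 : G) 1)) :=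
    Continuous.tendsto (by fun_prop) _
  filter_upwards [hc.eventually eventually_differentiableAt_chartMul,
    extChartAt_target_mem_nhds (I := 𝓘(ℝ, E)) (1 : G)] with x hx hxt
  have hxs := (extChartAt 𝓘(ℝ, E) (1 : G)).map_target hxt
  set φ := extChartAt 𝓘(ℝ, E) (1 : G) with hφ
  have hinv := ContinuousLinearMap.inverse_eq
    (mfderivWithin_extChartAt_symm_comp_mfderiv_extChartAt (I := 𝓘(ℝ, E)) hxt)
    (mfderiv_extChartAt_comp_mfderivWithin_extChartAt_symm (I := 𝓘(ℝ, E)) hxt)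
  rw [ModelWithCorners.range_eq_univ] at hinv
  rw [chartField, mpullbackWithin_apply, hinv]
  have hφ1 : φ.symm (φ 1) = 1 := by simp [hφ]
  have hL := hasMFDerivAt_congr_point (f := fun y : G => φ.symm x * y) hφ1
    ((contMDiff_mul_left.mdifferentiableAt (by simp :
      (∞ : WithTop ℕ∞) ≠ 0)).hasMFDerivAt (I := 𝓘(ℝ, E)) (I' := 𝓘(ℝ, E)))
  have hφx := hasMFDerivAt_congr_point' (p := φ.symm x * φ.symm (φ 1)) (q := φ.symm x) (f := φ)
    (by rw [hφ1, mul_one])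
    ((mdifferentiableAt_extChartAt (I := 𝓘(ℝ, E)) (x := (1 : G)) (y := φ.symm x)
      (by simpa [hφ] using hxs)).hasMFDerivAt)
  have h1 := HasMFDerivAt.comp (g := φ) (φ 1) hφx
    (HasMFDerivAt.comp (g := fun y : G => φ.symm x * y) (φ 1) hL hasMFDerivAt_symm_chart)
  have h2 : HasFDerivAt (fun y => chartMul G (x, y)) ((show E →L[ℝ] E from
      mfderiv 𝓘(ℝ, E) 𝓘(ℝ, E) φ (φ.symm x)).comp ((show E →L[ℝ] E from
      mfderiv 𝓘(ℝ, E) 𝓘(ℝ, E) (fun y : G => φ.symm x * y) 1).comp (ContinuousLinearMap.id ℝ E)))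
      (φ 1) := h1.hasFDerivAt
  have h3 : HasFDerivAt (fun y => chartMul G (x, y))
      ((fderiv ℝ (chartMul G) (x, φ 1)).comp (ContinuousLinearMap.inr ℝ E E)) (φ 1) :=
    hx.hasFDerivAt.comp (φ 1) (hasFDerivAt_prodMk_right x (φ 1))
  have h4 := h2.unique h3
  have h5 := congrArg (fun L : E →L[ℝ] E => L Y) h4
  exact h5

/-- The derivative of multiplication in the second variable, through `Ad`. -/
theorem fderiv_chartMul_swap (Y : E) :
    (fun x : E => fderiv ℝ (chartMul G) (x, extChartAt 𝓘(ℝ, E) (1 : G) 1) ((0 : E), Y))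
      =ᶠ[𝓝 (extChartAt 𝓘(ℝ, E) (1 : G) 1)]
    fun x => fderiv ℝ (chartMul G) (extChartAt 𝓘(ℝ, E) (1 : G) 1, x)
      (AdE ((extChartAt 𝓘(ℝ, E) (1 : G)).symm x) Y, (0 : E)) := by
  have hc : Tendsto (fun x : E => (x, extChartAt 𝓘(ℝ, E) (1 : G) 1))
      (𝓝 (extChartAt 𝓘(ℝ, E) (1 : G) 1))
      (𝓝 (extChartAt 𝓘(ℝ, E) (1 : G) 1, extChartAt 𝓘(ℝ, E) (1 : G) 1)) :=
    Continuous.tendsto (by fun_prop) _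
  have hc' : Tendsto (fun x : E => (extChartAt 𝓘(ℝ, E) (1 : G) 1, x))
      (𝓝 (extChartAt 𝓘(ℝ, E) (1 : G) 1))
      (𝓝 (extChartAt 𝓘(ℝ, E) (1 : G) 1, extChartAt 𝓘(ℝ, E) (1 : G) 1)) :=
    Continuous.tendsto (by fun_prop) _
  filter_upwards [hc.eventually eventually_differentiableAt_chartMul,
    hc'.eventually eventually_differentiableAt_chartMul] with x hx hx'
  set φ := extChartAt 𝓘(ℝ, E) (1 : G) with hφ
  have hφ1 : φ.symm (φ 1) = 1 := by simp [hφ]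
  have hconj := hasMFDerivAt_congr_point (f := fun y : G => φ.symm x * y * (φ.symm x)⁻¹) hφ1
    (mdifferentiableAt_conj (E := E) (φ.symm x) 1).hasMFDerivAt
  have h1 := HasMFDerivAt.comp (g := φ) (φ 1)
    (hasMFDerivAt_chart_of_eq_one (φ.symm x * φ.symm (φ 1) * (φ.symm x)⁻¹) (by simp [hφ1]))
    (HasMFDerivAt.comp (g := fun y : G => φ.symm x * y * (φ.symm x)⁻¹) (φ 1) hconj
      hasMFDerivAt_symm_chart)
  have h2 : HasFDerivAt (fun y : E => φ (φ.symm x * φ.symm y * (φ.symm x)⁻¹)) (AdE (φ.symm x))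
    (φ 1) := h1.hasFDerivAt
  have hφ2 : φ (φ.symm x * φ.symm (φ 1) * (φ.symm x)⁻¹) = φ 1 := by simp [hφ1]
  have h3 : HasFDerivAt (fun y => chartMul G (x, y))
      ((fderiv ℝ (chartMul G) (x, φ 1)).comp (ContinuousLinearMap.inr ℝ E E)) (φ 1) :=
    hx.hasFDerivAt.comp (φ 1) (hasFDerivAt_prodMk_right x (φ 1))
  have hx'' : HasFDerivAt (chartMul G) (fderiv ℝ (chartMul G) (φ 1, x))
      (φ (φ.symm x * φ.symm (φ 1) * (φ.symm x)⁻¹), x) := by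
    rw [hφ2]; exact hx'.hasFDerivAt
  have h4 := hx''.comp (φ 1) (h2.prodMk (hasFDerivAt_const x (φ 1)))
  -- This is the identity xy = (xyx⁻¹)x read in the chart.
  have h5 : (fun y => chartMul G (x, y)) =ᶠ[𝓝 (φ 1)]
      (chartMul G) ∘ fun y => (φ (φ.symm x * φ.symm y * (φ.symm x)⁻¹), x) := by
    have hs : ∀ᶠ y in 𝓝 (φ 1), φ.symm x * φ.symm y * (φ.symm x)⁻¹ ∈ φ.source := by
      have hcont : ContinuousAt (fun y => φ.symm x * φ.symm y * (φ.symm x)⁻¹) (φ 1) :=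
        ((mdifferentiableAt_conj (E := E) (φ.symm x) (φ.symm (φ 1))).continuousAt).comp
          (f := φ.symm) contMDiffAt_symm_chart.continuousAt
      refine hcont.preimage_mem_nhds ?_
      rw [hφ1]
      exact extChartAt_source_mem_nhds' (by simp)
    filter_upwards [hs] with y hy
    simp only [chartMul, Function.comp_apply, ← hφ, φ.left_inv hy]
    simp
  have h6 := (h3.congr_of_eventuallyEq h5.symm).unique h4
  have h7 := congrArg (fun L : E →L[ℝ] E => L Y) h6
  exact h7


theorem fderiv_chartMul_apply_right (Z : E) :
    fderiv ℝ (chartMul G) (extChartAt 𝓘(ℝ, E) (1 : G) 1, extChartAt 𝓘(ℝ, E) (1 : G) 1) ((0 : E), Z)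
      = Z := by
  set φ := extChartAt 𝓘(ℝ, E) (1 : G) with hφ
  have h3 : HasFDerivAt (fun y => chartMul G (φ 1, y))
      ((fderiv ℝ (chartMul G) (φ 1, φ 1)).comp (ContinuousLinearMap.inr ℝ E E)) (φ 1) :=
    (contDiffAt_chartMul.differentiableAt (by simp)).hasFDerivAt.comp (φ 1)
      (hasFDerivAt_prodMk_right (φ 1) (φ 1))
  have h5 : (fun y => chartMul G (φ 1, y)) =ᶠ[𝓝 (φ 1)] id := by
    filter_upwards [extChartAt_target_mem_nhds (I := 𝓘(ℝ, E)) (1 : G)] with x hx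
    have h1 : φ.symm (φ 1) = 1 := by simp [hφ]
    simp only [chartMul, ← hφ, h1, one_mul, id]
    exact φ.right_inv hx
  have h6 := h3.unique ((hasFDerivAt_id (φ 1)).congr_of_eventuallyEq h5)
  exact congrArg (fun L : E →L[ℝ] E => L Z) h6

theorem fderiv_chartMul_apply_left (Z : E) :
    fderiv ℝ (chartMul G) (extChartAt 𝓘(ℝ, E) (1 : G) 1, extChartAt 𝓘(ℝ, E) (1 : G) 1) (Z, (0 : E))
      = Z := by
  have h := (fderiv_chartMul_swap (G := G) Z).self_of_nhds
  have h1 : (extChartAt 𝓘(ℝ, E) (1 : G)).symm (extChartAt 𝓘(ℝ, E) (1 : G) 1) = 1 := by simp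
  have h2 : AdE (1 : G) Z = Z := by rw [AdE, Ad_one]; rfl
  simp only [h1, h2] at h
  rw [← h, fderiv_chartMul_apply_right]

theorem chartField_apply_one (X : LieAlg E G) :
    chartField X (extChartAt 𝓘(ℝ, E) (1 : G) 1) = X :=
  (chartField_eventuallyEq X).self_of_nhds.trans (fderiv_chartMul_apply_right (E := E) (G := G) X)

theorem hasFDerivAt_fderiv_chartMul :
    HasFDerivAt (fderiv ℝ (chartMul G : E × E → E)) (fderiv ℝ (fderiv ℝ (chartMul G : E × E → E))
      (extChartAt 𝓘(ℝ, E) (1 : G) 1, extChartAt 𝓘(ℝ, E) (1 : G) 1))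
      (extChartAt 𝓘(ℝ, E) (1 : G) 1, extChartAt 𝓘(ℝ, E) (1 : G) 1) :=
  ((contDiffAt_chartMul.fderiv_right (m := ∞) (by simp)).differentiableAt (by simp)).hasFDerivAt

theorem hasFDerivAt_fderiv_chartMul_right (Y : E) :
    HasFDerivAt (fun x : E => fderiv ℝ (chartMul G) (x, extChartAt 𝓘(ℝ, E) (1 : G) 1) ((0 : E), Y))
      (((ContinuousLinearMap.apply ℝ E ((0 : E), Y)).comp
        (fderiv ℝ (fderiv ℝ (chartMul G : E × E → E))
      (extChartAt 𝓘(ℝ, E) (1 : G) 1, extChartAt 𝓘(ℝ, E) (1 : G) 1))).comp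
        (ContinuousLinearMap.inl ℝ E E)) (extChartAt 𝓘(ℝ, E) (1 : G) 1) :=
  HasFDerivAt.comp (f := fun x => (x, extChartAt 𝓘(ℝ, E) (1 : G) 1))
    (extChartAt 𝓘(ℝ, E) (1 : G) 1)
    ((ContinuousLinearMap.apply ℝ E ((0 : E), Y)).hasFDerivAt.comp _ hasFDerivAt_fderiv_chartMul)
    (hasFDerivAt_prodMk_left _ _)

theorem fderiv_chartField (X Y : LieAlg E G) :
    fderiv ℝ (chartField Y) (extChartAt 𝓘(ℝ, E) (1 : G) 1) (X : E)
    = fderiv ℝ (fderiv ℝ (chartMul G : E × E → E))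
      (extChartAt 𝓘(ℝ, E) (1 : G) 1, extChartAt 𝓘(ℝ, E) (1 : G) 1) ((X : E), (0 : E))
      ((0 : E), (Y : E)) := by
  rw [(chartField_eventuallyEq Y).fderiv_eq]
  exact congrArg (fun L : E →L[ℝ] E => L X) 
    (hasFDerivAt_fderiv_chartMul_right (E := E) (G := G) Y).fderiv

/-- Differentiate xy = (xyx⁻¹)x in y at 1, then in x at 1. The product rule yields the opposite
mixed derivative plus the derivative of `AdE`. -/
theorem fderiv_fderiv_chartMul_swap (X Y : E) :
    fderiv ℝ (fderiv ℝ (chartMul G : E × E → E))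
      (extChartAt 𝓘(ℝ, E) (1 : G) 1, extChartAt 𝓘(ℝ, E) (1 : G) 1) (X, (0 : E)) ((0 : E), Y) =
    fderiv ℝ (fderiv ℝ (chartMul G : E × E → E))
      (extChartAt 𝓘(ℝ, E) (1 : G) 1, extChartAt 𝓘(ℝ, E) (1 : G) 1) (Y, (0 : E)) ((0 : E), X) +
    fderiv ℝ (fun x : E => (AdE ((extChartAt 𝓘(ℝ, E) (1 : G)).symm x) : E →L[ℝ] E))
      (extChartAt 𝓘(ℝ, E) (1 : G) 1) X Y := by
  set e := extChartAt 𝓘(ℝ, E) (1 : G) 1 with he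
  have hA : HasFDerivAt (fun x : E => (AdE ((extChartAt 𝓘(ℝ, E) (1 : G)).symm x) : E →L[ℝ] E))
      (fderiv ℝ (fun x : E => (AdE ((extChartAt 𝓘(ℝ, E) (1 : G)).symm x) : E →L[ℝ] E)) e) e :=
    (contDiffAt_AdE_symm_chart.differentiableAt (by simp)).hasFDerivAt
  have h1 : AdE ((extChartAt 𝓘(ℝ, E) (1 : G)).symm e) = ContinuousLinearMap.id ℝ E := by
    rw [he, extChartAt_to_inv]; exact Ad_one
  have hAY : HasFDerivAt (fun x : E => ((AdE ((extChartAt 𝓘(ℝ, E) (1 : G)).symm x) : E →L[ℝ] E) Y,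
      (0 : E))) _ e :=
    ((ContinuousLinearMap.inl ℝ E E).comp (ContinuousLinearMap.apply ℝ E Y)).hasFDerivAt.comp e hA
  have hD : HasFDerivAt (fun x : E => fderiv ℝ (chartMul G) (e, x)) _ e :=
    (hasFDerivAt_fderiv_chartMul (E := E) (G := G)).comp e (hasFDerivAt_prodMk_right e e)
  have h2 := (hD.clm_apply hAY).congr_of_eventuallyEq (fderiv_chartMul_swap (G := G) Y)
  have h3 := congrArg (fun L : E →L[ℝ] E => L X) ((hasFDerivAt_fderiv_chartMul_right Y).unique h2)
  simp only [ContinuousLinearMap.comp_apply, _root_.add_apply, h1,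
    ContinuousLinearMap.flip_apply, ContinuousLinearMap.inl_apply, ContinuousLinearMap.apply_apply,
    ContinuousLinearMap.inr_apply, ContinuousLinearMap.id_apply, ← he] at h3
  rw [h3, fderiv_chartMul_symm, add_comm, fderiv_chartMul_apply_left]

/-- The bracket of left-invariant fields at 1 is the difference of the two mixed second derivatives
of multiplication, and the swap identity evaluates that difference. -/
theorem lie_eq_fderiv_AdE (X Y : LieAlg E G) :
    (⁅X, Y⁆ : LieAlg E G) = (fderiv ℝ
      (fun x : E => (AdE ((extChartAt 𝓘(ℝ, E) (1 : G)).symm x) : E →L[ℝ] E))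
      (extChartAt 𝓘(ℝ, E) (1 : G) 1) : E →L[ℝ] E →L[ℝ] E) X Y := by
  have : IsManifold 𝓘(ℝ, E) 1 G := IsManifold.of_le (n := ∞) (by simp)
  have hid : ∀ v : E, (mfderiv 𝓘(ℝ, E) 𝓘(ℝ, E) (extChartAt 𝓘(ℝ, E) (1 : G)) 1).inverse v = v := by
    intro v
    rw [mfderiv_extChartAt_self]
    change (ContinuousLinearMap.inverse (ContinuousLinearMap.id ℝ E)) v = v
    rw [ContinuousLinearMap.inverse_id]
    rfl
  rw [GroupLieAlgebra.bracket_def, ← mlieBracketWithin_univ, mlieBracketWithin_apply]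
  rw [ModelWithCorners.range_eq_univ, preimage_univ, inter_univ]
  refine (hid _).trans ?_
  change lieBracketWithin ℝ (chartField X) (chartField Y) univ _ = _
  rw [lieBracketWithin_univ, lieBracket, chartField_apply_one, chartField_apply_one,
    fderiv_chartField, fderiv_chartField, fderiv_fderiv_chartMul_swap (E := E) X Y]
  exact add_sub_cancel_left (G := E) _ _

theorem hasMFDerivAt_AdE_one :
    ∃ D : E →L[ℝ] E →L[ℝ] E, (∀ X Y : LieAlg E G, D X Y = (⁅X, Y⁆ : LieAlg E G)) ∧
      HasMFDerivAt 𝓘(ℝ, E) 𝓘(ℝ, E →L[ℝ] E) (AdE : G → E →L[ℝ] E) 1 D := by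
  have hA := (contMDiff_AdE (E := E) (G := G)).mdifferentiableAt (x := 1) (by simp)
  have h1 : (extChartAt 𝓘(ℝ, E) (1 : G)).symm (extChartAt 𝓘(ℝ, E) (1 : G) 1) = 1 := by simp
  have hA' : HasMFDerivAt 𝓘(ℝ, E) 𝓘(ℝ, E →L[ℝ] E) (AdE : G → E →L[ℝ] E)
      ((extChartAt 𝓘(ℝ, E) (1 : G)).symm (extChartAt 𝓘(ℝ, E) (1 : G) 1))
      (show E →L[ℝ] E →L[ℝ] E from
        mfderiv 𝓘(ℝ, E) 𝓘(ℝ, E →L[ℝ] E) (AdE : G → E →L[ℝ] E) 1) := by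
    rw [h1]; exact hA.hasMFDerivAt
  have h2 : HasFDerivAt (fun x : E => (AdE ((extChartAt 𝓘(ℝ, E) (1 : G)).symm x) : E →L[ℝ] E))
      ((show E →L[ℝ] E →L[ℝ] E from
        mfderiv 𝓘(ℝ, E) 𝓘(ℝ, E →L[ℝ] E) (AdE : G → E →L[ℝ] E) 1).comp
        (ContinuousLinearMap.id ℝ E)) _ := (HasMFDerivAt.comp (g := (AdE : G → E →L[ℝ] E)) _ hA'
    hasMFDerivAt_symm_chart).hasFDerivAt
  refine ⟨_, fun X Y => ?_, hA.hasMFDerivAt⟩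
  rw [lie_eq_fderiv_AdE]
  exact congrArg (fun L : E →L[ℝ] E →L[ℝ] E => L X Y) h2.fderiv.symm

end AdjointRepresentation

/-! ### One-parameter subgroups, the exponential formula, and differentials of homomorphisms. -/

section OneParameterSubgroups

set_option linter.unusedSectionVars false

variable {E : Type*} [NormedAddCommGroup E] [NormedSpace ℝ E]
  {G : Type*} [TopologicalSpace G] [ChartedSpace E G] [Group G] [LieGroup 𝓘(ℝ, E) ∞ G]

theorem mdifferentiableAt_mul_left (g x : G) :
    MDifferentiableAt 𝓘(ℝ, E) 𝓘(ℝ, E) (fun y : G => g * y) x :=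
  contMDiff_mul_left.mdifferentiableAt (by simp : (∞ : WithTop ℕ∞) ≠ 0)

theorem AdE_one : (AdE (1 : G) : E →L[ℝ] E) = 1 := Ad_one

theorem AdE_mul (g h : G) : (AdE (g * h) : E →L[ℝ] E) = AdE g * AdE h := Ad_mul g h

theorem comp_smulRight_one (L : E →L[ℝ] E) (v : E) :
    L.comp ((1 : ℝ →L[ℝ] ℝ).smulRight v) = (1 : ℝ →L[ℝ] ℝ).smulRight (L v) := by
  ext; simp

theorem mfderiv_mul_left_mulInvariantVectorField (h g : G) (Z : LieAlg E G) :
    mfderiv 𝓘(ℝ, E) 𝓘(ℝ, E) (fun y : G => h * y) g (mulInvariantVectorField Z g) =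
      mulInvariantVectorField Z (h * g) := by
  have h1 := mfderiv_comp (I := 𝓘(ℝ, E)) (I' := 𝓘(ℝ, E)) (I'' := 𝓘(ℝ, E)) (1 : G)
    (g := fun y : G => h * y) (f := fun y : G => g * y)
    (mdifferentiableAt_mul_left h _) (mdifferentiableAt_mul_left g 1)
  have h2 : (fun y : G => h * y) ∘ (fun y : G => g * y) = fun y => h * g * y := by
    ext; simp [mul_assoc]
  rw [h2] at h1
  let F : G → E →L[ℝ] E := fun p => mfderiv 𝓘(ℝ, E) 𝓘(ℝ, E) (fun y : G => h * y) p
  have h3 : (mulInvariantVectorField Z (h * g) : E) = F (g * 1) (mulInvariantVectorField Z g : E) :=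
    congrArg (fun L : E →L[ℝ] E => L Z) h1
  rw [mul_one] at h3
  exact h3.symm

theorem mfderiv_hom_mulInvariantVectorField (f : G →* G) (hf : ContMDiff 𝓘(ℝ, E) 𝓘(ℝ, E) ∞ f)
    (g : G) (Z : LieAlg E G) :
    mfderiv 𝓘(ℝ, E) 𝓘(ℝ, E) f g (mulInvariantVectorField Z g) =
      mulInvariantVectorField (diffOne f Z) (f g) := by
  have hf' : ∀ x, MDifferentiableAt 𝓘(ℝ, E) 𝓘(ℝ, E) f x := fun x => hf.mdifferentiableAt (by simp)
  have h1 := mfderiv_comp (I := 𝓘(ℝ, E)) (I' := 𝓘(ℝ, E)) (I'' := 𝓘(ℝ, E)) (1 : G)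
    (g := f) (f := fun y : G => g * y) (hf' _) (mdifferentiableAt_mul_left g 1)
  have h1' := mfderiv_comp (I := 𝓘(ℝ, E)) (I' := 𝓘(ℝ, E)) (I'' := 𝓘(ℝ, E)) (1 : G)
    (g := fun y : G => f g * y) (f := f) (mdifferentiableAt_mul_left (f g) _) (hf' _)
  have h2 : (fun y : G => f g * y) ∘ f = f ∘ (fun y : G => g * y) := by
    ext; simp
  rw [h2] at h1'
  let F : G → E →L[ℝ] E := fun p => mfderiv 𝓘(ℝ, E) 𝓘(ℝ, E) f p
  let F' : G → E →L[ℝ] E := fun p => mfderiv 𝓘(ℝ, E) 𝓘(ℝ, E) (fun y : G => f g * y) p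
  have h3 : F (g * 1) (mulInvariantVectorField Z g : E) = F' (f 1) (F 1 (Z : E)) :=
    congrArg (fun L : E →L[ℝ] E => L Z) (h1.symm.trans h1')
  rw [mul_one, map_one] at h3
  exact h3

theorem IsMIntegralCurveOn.mul_left {c : ℝ → G} {Z : LieAlg E G} {s : Set ℝ}
    (hc : IsMIntegralCurveOn (I := 𝓘(ℝ, E)) c (mulInvariantVectorField Z) s) (h : G) :
    IsMIntegralCurveOn (I := 𝓘(ℝ, E)) (fun t => h * c t) (mulInvariantVectorField Z) s := by
  intro t ht
  have h1 := HasMFDerivAt.comp_hasMFDerivWithinAt (g := fun y : G => h * y) t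
    (mdifferentiableAt_mul_left (E := E) h (c t)).hasMFDerivAt (hc t ht)
  refine h1.congr_mfderiv ?_
  rw [← mfderiv_mul_left_mulInvariantVectorField]
  exact comp_smulRight_one (E := E) _ _

theorem IsMIntegralCurve.map_hom {c : ℝ → G} {Z : LieAlg E G} (f : G →* G)
    (hf : ContMDiff 𝓘(ℝ, E) 𝓘(ℝ, E) ∞ f)
    (hc : IsMIntegralCurve (I := 𝓘(ℝ, E)) c (mulInvariantVectorField Z)) :
    IsMIntegralCurve (I := 𝓘(ℝ, E)) (fun t => f (c t)) (mulInvariantVectorField (diffOne f Z)) := by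
  intro t
  have h1 := HasMFDerivAt.comp (g := f) t
    (hf.mdifferentiableAt (by simp)).hasMFDerivAt (hc t)
  refine h1.congr_mfderiv ?_
  rw [← mfderiv_hom_mulInvariantVectorField f hf]
  exact comp_smulRight_one (E := E) _ _

theorem contMDiff_mulInvariantVectorField_one (Z : LieAlg E G) :
    ContMDiff 𝓘(ℝ, E) 𝓘(ℝ, E).tangent 1
      (fun g : G => (⟨g, mulInvariantVectorField Z g⟩ : TangentBundle 𝓘(ℝ, E) G)) := by
  have := contMDiff_mulInvariantVectorField (I := 𝓘(ℝ, E)) (G := G) Z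
  refine this.of_le ?_
  rw [minSmoothness_of_isRCLikeNormedField]
  exact one_le_two

/-- Every left-invariant vector field is complete. -/
theorem exists_isMIntegralCurve_mulInvariantVectorField [FiniteDimensional ℝ E] [T2Space G]
    (Z : LieAlg E G) :
    ∃ c : ℝ → G, c 0 = 1 ∧ IsMIntegralCurve (I := 𝓘(ℝ, E)) c (mulInvariantVectorField Z) := by
  have : IsManifold 𝓘(ℝ, E) 1 G := IsManifold.of_le (n := ∞) (by simp)
  have : CompleteSpace E := FiniteDimensional.complete ℝ E
  obtain ⟨c, hc0, hc⟩ := exists_isMIntegralCurveAt_of_contMDiffAt_boundaryless 0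
    ((contMDiff_mulInvariantVectorField_one Z).contMDiffAt (x := 1))
  obtain ⟨ε, hε, hc⟩ := isMIntegralCurveAt_iff'.1 hc
  -- Left translates of one local solution give the same existence time ε at every point.
  refine exists_isMIntegralCurve_of_isMIntegralCurveOn (contMDiff_mulInvariantVectorField_one Z)
    hε (fun x => ⟨fun t => x * c t, by simp [hc0], ?_⟩) 1
  rw [Real.ball_eq_Ioo, zero_sub, zero_add] at hc
  exact IsMIntegralCurveOn.mul_left hc x

/-- The adjoint representation of the Lie algebra. -/
def adE (G : Type*) [TopologicalSpace G] [ChartedSpace E G] [Group G] [LieGroup 𝓘(ℝ, E) ∞ G] :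
    E →L[ℝ] E →L[ℝ] E :=
  (hasMFDerivAt_AdE_one (E := E) (G := G)).choose

theorem adE_apply (X Y : LieAlg E G) : adE (E := E) G X Y = (⁅X, Y⁆ : LieAlg E G) :=
  (hasMFDerivAt_AdE_one (E := E) (G := G)).choose_spec.1 X Y

theorem hasMFDerivAt_AdE :
    HasMFDerivAt 𝓘(ℝ, E) 𝓘(ℝ, E →L[ℝ] E) (AdE : G → E →L[ℝ] E) 1 (adE (E := E) G) :=
  (hasMFDerivAt_AdE_one (E := E) (G := G)).choose_spec.2

theorem hasMFDerivAt_AdE_of_eq_one {g : G} (hg : g = 1) :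
    HasMFDerivAt 𝓘(ℝ, E) 𝓘(ℝ, E →L[ℝ] E) (AdE : G → E →L[ℝ] E) g (adE (E := E) G) := by
  subst hg; exact hasMFDerivAt_AdE

/-- Writing Ad(c(s)) = Ad(c(t)) Ad(c(t)⁻¹c(s)) reduces the derivative at time t to the derivative of
`AdE` at 1. -/
theorem hasDerivAt_AdE_isMIntegralCurve {c : ℝ → G} {Z : LieAlg E G}
    (hc : IsMIntegralCurve (I := 𝓘(ℝ, E)) c (mulInvariantVectorField Z)) (t : ℝ) :
    HasDerivAt (fun s => (AdE (c s) : E →L[ℝ] E)) (AdE (c t) * adE (E := E) G (Z : E)) t := by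
  have h1 := IsMIntegralCurveOn.mul_left (isMIntegralCurve_iff_isMIntegralCurveOn.1 hc) (c t)⁻¹
  have h2 := isMIntegralCurve_iff_isMIntegralCurveOn.2 h1 t
  have hv : (mulInvariantVectorField Z ((c t)⁻¹ * c t) : E) = Z := by
    rw [inv_mul_cancel]
    have h : (fun y : G => 1 * y) = id := by ext; simp
    rw [mulInvariantVectorField, h]
    exact congrArg (fun L : E →L[ℝ] E => L Z) mfderiv_id
  have h3 : HasFDerivAt (fun s => (AdE ((c t)⁻¹ * c s) : E →L[ℝ] E))
      ((adE (E := E) G).comp ((1 : ℝ →L[ℝ] ℝ).smulRight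
        (mulInvariantVectorField Z ((c t)⁻¹ * c t) : E))) t :=
    (HasMFDerivAt.comp (g := (AdE : G → E →L[ℝ] E)) t
    (hasMFDerivAt_AdE_of_eq_one (E := E) (inv_mul_cancel (c t))) h2).hasFDerivAt
  rw [hv] at h3
  have h6 : ((1 : ℝ →L[ℝ] ℝ).smulRight (Z : E)) 1 = (Z : E) := one_smul ℝ (Z : E)
  have h4 := HasDerivAt.const_mul (AdE (c t) : E →L[ℝ] E)
    (h3.hasDerivAt.congr_deriv (congrArg (adE (E := E) G) h6))
  have h5 : (fun s => (AdE (c s) : E →L[ℝ] E)) = fun s => AdE (c t) * AdE ((c t)⁻¹ * c s) := by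
    ext1 s
    rw [← AdE_mul, mul_inv_cancel_left]
  rw [h5]
  exact h4

/-- A curve in an algebra of operators which solves `A' = A L` and starts at `1` is the
exponential of `t L`. -/
theorem eq_exp_of_hasDerivAt [FiniteDimensional ℝ E] {A : ℝ → E →L[ℝ] E} {L : E →L[ℝ] E}
    (h0 : A 0 = 1) (hA : ∀ t, HasDerivAt A (A t * L) t) (t : ℝ) :
    A t = NormedSpace.exp (t • L) := by
  have : CompleteSpace E := FiniteDimensional.complete ℝ E
  -- The product A(u) exp(-uL) is constant.
  have h1 : ∀ s, HasDerivAt (fun u : ℝ => A u * NormedSpace.exp (u • -L)) 0 s := by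
    intro s
    have h := (hA s).mul (hasDerivAt_exp_smul_const' (𝕂 := ℝ) (-L) s)
    convert! h using 1
    noncomm_ring
  have h2 := is_const_of_deriv_eq_zero (fun s => (h1 s).differentiableAt) (fun s => (h1 s).deriv) t 0
  simp only [h0, zero_smul, NormedSpace.exp_zero, mul_one] at h2
  have h3 : NormedSpace.exp (t • -L) * NormedSpace.exp (t • L) = 1 := by
    have hc : Commute (t • -L) (t • L) :=
      (((Commute.refl L).neg_left).smul_left t).smul_right t
    let _ : NormedAlgebra ℚ (E →L[ℝ] E) := .restrictScalars ℚ ℝ _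
    rw [← NormedSpace.exp_add_of_commute hc]
    simp
  calc A t = A t * (NormedSpace.exp (t • -L) * NormedSpace.exp (t • L)) := by rw [h3, mul_one]
    _ = _ := by rw [← mul_assoc, h2, one_mul]

/-- Since θ fixes Z, it maps the integral curve of Z through 1 to another one, hence to itself by
uniqueness. The curve is therefore a connected set of fixed points through 1, and lies in K. -/
theorem exists_AdE_eq_exp [FiniteDimensional ℝ E] [T2Space G] {θ : G →* G} {K : Subgroup G}
    (hGK : IsSymmetricPair E θ K) {Z : LieAlg E G} (hZ : diffOne θ Z = Z) :
    ∃ k ∈ K, (AdE k : E →L[ℝ] E) = NormedSpace.exp (adE (E := E) G Z) := by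
  have : IsManifold 𝓘(ℝ, E) 1 G := IsManifold.of_le (n := ∞) (by simp)
  obtain ⟨c, hc0, hc⟩ := exists_isMIntegralCurve_mulInvariantVectorField Z
  have h1 := IsMIntegralCurve.map_hom θ hGK.smooth hc
  rw [hZ] at h1
  have h2 : (fun t => θ (c t)) = c :=
    isMIntegralCurve_Ioo_eq_of_contMDiff_boundaryless (t₀ := 0)
      (contMDiff_mulInvariantVectorField_one Z) h1 hc (by simp [hc0])
  have hcont : Continuous c := IsMIntegralCurve.continuous hc
  have h3 : range c ⊆ connectedComponentIn {g : G | θ g = g} 1 := by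
    refine (isPreconnected_range hcont).subset_connectedComponentIn ⟨0, hc0⟩ ?_
    rintro _ ⟨t, rfl⟩
    exact congrFun h2 t
  refine ⟨c 1, hGK.identityComponent_le (h3 ⟨1, rfl⟩), ?_⟩
  have := eq_exp_of_hasDerivAt (A := fun s => (AdE (c s) : E →L[ℝ] E))
    (by simp only [hc0]; exact AdE_one) (hasDerivAt_AdE_isMIntegralCurve hc) 1
  simpa using this

/-- Invariance under `Ad` implies skew-symmetry of `ad`. -/
theorem bilin_lie_of_invariant [FiniteDimensional ℝ E] [T2Space G]
    {B : LinearMap.BilinForm ℝ E}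
    (hB : ∀ (g : G) (X Y : E), B (AdE g X) (AdE g Y) = B X Y) (Z X Y : E) :
    B (adE (E := E) G Z X) Y = -B X (adE (E := E) G Z Y) := by
  obtain ⟨c, hc0, hc⟩ := exists_isMIntegralCurve_mulInvariantVectorField (G := G) (E := E) Z
  have h1 := hasDerivAt_AdE_isMIntegralCurve hc 0
  rw [hc0, AdE_one, one_mul] at h1
  have hX := h1.clm_apply (hasDerivAt_const 0 X)
  have hY := h1.clm_apply (hasDerivAt_const 0 Y)
  let B' : E →L[ℝ] E →L[ℝ] ℝ :=
    LinearMap.toContinuousLinearMap (LinearMap.toContinuousLinearMap.toLinearMap ∘ₗ B)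
  have h2 := (B'.hasFDerivAt.comp_hasDerivAt (0 : ℝ) hX).clm_apply hY
  have h3 : (fun s => (B' ∘ fun s => (AdE (c s) : E →L[ℝ] E) X) s ((AdE (c s) : E →L[ℝ] E) Y)) =
      fun _ => B X Y := by
    ext1 s
    exact hB _ _ _
  have h4 := h2.unique (h3 ▸ hasDerivAt_const (0 : ℝ) (B X Y))
  simp only [Function.comp_apply, hc0, AdE_one, map_zero, add_zero] at h4
  have h5 : B (adE (E := E) G Z X) Y + B X (adE (E := E) G Z Y) = 0 := h4
  linarith

theorem diffOne_comp_AdE (f : G →* G) (hf : ContMDiff 𝓘(ℝ, E) 𝓘(ℝ, E) ∞ f) (g : G) :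
    (diffOne f : LieAlg E G →L[ℝ] LieAlg E G).comp (Ad g) = (Ad (f g)).comp (diffOne f) := by
  have hf1 : MDifferentiableAt 𝓘(ℝ, E) 𝓘(ℝ, E) f 1 := hf.mdifferentiableAt (by simp)
  rw [Ad, Ad, ← diffOne_comp hf1 (mdifferentiableAt_conj g 1) (by simp),
    ← diffOne_comp (mdifferentiableAt_conj (f g) 1) hf1 (by simp)]
  congr 1
  ext x
  simp

/-- The differential of a homomorphism of Lie groups is a homomorphism of Lie algebras. -/
theorem diffOne_lie (f : G →* G) (hf : ContMDiff 𝓘(ℝ, E) 𝓘(ℝ, E) ∞ f) (X Y : LieAlg E G) :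
    diffOne f ⁅X, Y⁆ = ⁅(diffOne f X : LieAlg E G), (diffOne f Y : LieAlg E G)⁆ := by
  let F : E →L[ℝ] E := (diffOne f : LieAlg E G →L[ℝ] LieAlg E G)
  have hf1 : HasMFDerivAt 𝓘(ℝ, E) 𝓘(ℝ, E) f 1 F :=
    (hf.mdifferentiableAt (by simp)).hasMFDerivAt
  have h1 := HasMFDerivAt.comp (g := (AdE : G → E →L[ℝ] E)) 1
    (hasMFDerivAt_AdE_of_eq_one (E := E) (map_one f)) hf1
  have h2 := HasMFDerivAt.comp (g := fun L : E →L[ℝ] E => F.comp L) (1 : G)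
    (((ContinuousLinearMap.compL ℝ E E E) F).hasFDerivAt.hasMFDerivAt)
    (hasMFDerivAt_AdE (E := E))
  have h3 := HasMFDerivAt.comp (g := fun L : E →L[ℝ] E => L.comp F) (1 : G)
    ((((ContinuousLinearMap.compL ℝ E E E).flip F)).hasFDerivAt.hasMFDerivAt) h1
  -- Both sides of df ∘ Ad(g) = Ad(f(g)) ∘ df are differentiated in g at 1.
  have h4 : (fun L : E →L[ℝ] E => F.comp L) ∘ (AdE : G → E →L[ℝ] E) =
      (fun L : E →L[ℝ] E => L.comp F) ∘ (AdE : G → E →L[ℝ] E) ∘ f := by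
    ext1 g
    exact diffOne_comp_AdE f hf g
  rw [h4] at h2
  have h5 := congrArg (fun L : E →L[ℝ] E →L[ℝ] E => L X Y) (hasMFDerivAt_unique h2 h3)
  rw [← adE_apply, ← adE_apply]
  exact h5

end OneParameterSubgroups

/-! ### Polynomial identities and nilpotency of operators. -/

section Operators

open Polynomial

/-- The difference of two commuting roots of a nonzero polynomial is a root of a nonzero polynomial
which depends only on the given one. -/
theorem exists_aeval_sub_eq_zero {p : ℝ[X]} (hp : p ≠ 0) (R : Type*) [Ring R] [Algebra ℝ R] :
    ∃ q : ℝ[X], q ≠ 0 ∧ ∀ A A' : R, Commute A A' → aeval A p = 0 → aeval A' p = 0 →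
      aeval (A' - A) q = 0 := by
  let Q := ℝ[X] ⧸ Ideal.span {p}
  have : Module.Finite ℝ Q := (AdjoinRoot.powerBasis hp).finite
  let x : Q := Ideal.Quotient.mk _ X
  -- Q ⊗ Q is the universal algebra with two commuting roots of p. It is finite-dimensional, so the
  -- minimal polynomial of this difference serves every pair.
  let d : Q ⊗[ℝ] Q := x ⊗ₜ 1 - 1 ⊗ₜ x
  refine ⟨minpoly ℝ d, minpoly.ne_zero (IsIntegral.of_finite ℝ d), fun A A' hc hA hA' => ?_⟩
  have hl : ∀ C : R, aeval C p = 0 → ∀ a ∈ Ideal.span {p}, aeval C a = 0 := by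
    intro C hC a ha
    obtain ⟨b, rfl⟩ := Ideal.mem_span_singleton'.1 ha
    rw [map_mul, hC, mul_zero]
  let f : (C : R) → aeval C p = 0 → Q →ₐ[ℝ] R := fun C hC =>
    Ideal.Quotient.liftₐ (Ideal.span {p}) (aeval C) (hl C hC)
  have hfx : ∀ C hC, f C hC x = C := fun C hC => by
    simp only [f, x]
    exact (Ideal.Quotient.lift_mk _ _ _).trans (aeval_X C)
  have hf : ∀ a b, Commute (f A' hA' a) (f A hA b) := by
    intro a b
    obtain ⟨a, rfl⟩ := Ideal.Quotient.mk_surjective a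
    obtain ⟨b, rfl⟩ := Ideal.Quotient.mk_surjective b
    change Commute (aeval A' a) (aeval A b)
    have h1 : ∀ (C D : R) (c : ℝ[X]), Commute C D → Commute C (aeval D c) := by
      intro C D c h
      induction c using Polynomial.induction_on' with
      | add c d hc hd => rw [map_add]; exact hc.add_right hd
      | monomial n r =>
        rw [aeval_monomial]
        exact Commute.mul_right (Algebra.commutes r C).symm (h.pow_right n)
    exact h1 _ _ _ (h1 _ _ _ hc).symm
  let Φ := Algebra.TensorProduct.lift (f A' hA') (f A hA) hf
  have hΦ : Φ d = A' - A := by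
    simp [Φ, d, hfx]
  rw [← hΦ, aeval_algHom_apply, minpoly.aeval, map_zero]

/-- Operators near `0` which are annihilated by a given nonzero polynomial are nilpotent. -/
theorem exists_forall_norm_lt_pow_eq_zero {V : Type*} [NormedAddCommGroup V]
    [NormedSpace ℝ V] [FiniteDimensional ℝ V] {q : ℝ[X]} (hq : q ≠ 0) :
    ∃ ε > 0, ∀ S : V →L[ℝ] V, ‖S‖ < ε → aeval S q = 0 → ∃ m : ℕ, S ^ m = 0 := by
  have : CompleteSpace V := FiniteDimensional.complete ℝ V
  -- Split off the power of X dividing q. The cofactor has nonzero constant term, so its value is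
  -- invertible at operators near 0 and can be cancelled.
  obtain ⟨r, hr, hrd⟩ := q.exists_eq_pow_rootMultiplicity_mul_and_not_dvd hq 0
  simp only [map_zero, sub_zero] at hr hrd
  rw [X_dvd_iff] at hrd
  have hu : ∀ᶠ S : V →L[ℝ] V in 𝓝 0, IsUnit (aeval S r) := by
    have hcont : Continuous fun S : V →L[ℝ] V => aeval S r := r.continuous_aeval
    refine hcont.continuousAt.eventually (Units.isOpen.mem_nhds ?_)
    change IsUnit (aeval (0 : V →L[ℝ] V) r)
    rw [← coeff_zero_eq_aeval_zero']
    exact (IsUnit.mk0 _ hrd).map (algebraMap ℝ (V →L[ℝ] V))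
  obtain ⟨ε, hε, h⟩ := Metric.eventually_nhds_iff.1 hu
  refine ⟨ε, hε, fun S hS hq0 => ⟨q.rootMultiplicity 0, ?_⟩⟩
  have h1 := h (y := S) (by simpa using hS)
  rw [hr, map_mul, map_pow, aeval_X] at hq0
  exact h1.mul_left_eq_zero.1 hq0

theorem aeval_units_conj {R : Type*} [Ring R] [Algebra ℝ R] (u : Rˣ) (a : R) (c : ℝ[X]) :
    aeval (u * a * ↑u⁻¹ : R) c = u * aeval a c * ↑u⁻¹ := by
  induction c using Polynomial.induction_on' with
  | add c d hc hd => rw [map_add, map_add, hc, hd, mul_add, add_mul]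
  | monomial n r =>
    rw [aeval_monomial, aeval_monomial, Units.conj_pow, ← mul_assoc, ← mul_assoc, ← mul_assoc,
      Algebra.commutes r (u : R)]

/-- For skew S the kernels of S² and S agree, since B(SX, SX) = -B(X, S²X); the exponent can thus be
lowered step by step. -/
theorem eq_zero_of_pow_eq_zero_of_skew {V : Type*} [NormedAddCommGroup V] [NormedSpace ℝ V] {B : LinearMap.BilinForm ℝ V}
    (hpos : ∀ X, X ≠ 0 → 0 < B X X) {S : V →L[ℝ] V} (hS : ∀ X Y, B (S X) Y = -B X (S Y)) {m : ℕ}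
    (hm : S ^ m = 0) : S = 0 := by
  have hsq : ∀ X, S (S X) = 0 → S X = 0 := by
    intro X hX
    by_contra h
    have := hpos _ h
    rw [hS, hX] at this
    simp at this
  induction m with
  | zero =>
    ext X
    simpa using congrArg (fun L : V →L[ℝ] V => S (L X)) hm
  | succ n ih =>
    rcases n with _ | n
    · simpa using hm
    · apply ih
      ext X
      have h1 := congrArg (fun L : V →L[ℝ] V => L X) hm
      simp only [pow_succ', mul_apply_eq_comp, zero_apply] at h1 ⊢
      exact hsq _ h1

end Operators
-- Conjugation into 𝔞, isolation of α, and the root reflection.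
section Isotropy

/-- The data of an irreducible orthogonal symmetric pair, on the level of the Lie algebra `V`. -/
structure IsotropyData (Γ V : Type*) [Group Γ] [TopologicalSpace Γ] [NormedAddCommGroup V]
    [NormedSpace ℝ V] where
  /-- the adjoint representation of the group -/
  Ad : Γ → V →L[ℝ] V
  /-- the adjoint representation of the Lie algebra -/
  ad : V →L[ℝ] V →L[ℝ] V
  /-- the involution -/
  T : V →L[ℝ] V
  /-- the isotropy group -/
  K : Subgroup Γ
  /-- the inner product -/
  B : LinearMap.BilinForm ℝ V
  Ad_one : Ad 1 = 1
  Ad_mul : ∀ g h, Ad (g * h) = Ad g * Ad h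
  continuous_Ad : Continuous Ad
  isCompact_K : IsCompact (K : Set Γ)
  Ad_ad : ∀ g X Y, Ad g (ad X Y) = ad (Ad g X) (Ad g Y)
  T_ad : ∀ X Y, T (ad X Y) = ad (T X) (T Y)
  T_T : ∀ X, T (T X) = X
  T_Ad : ∀ k ∈ K, ∀ X, T (Ad k X) = Ad k (T X)
  exists_Ad_eq_exp : ∀ Z, T Z = Z → ∃ k ∈ K, Ad k = NormedSpace.exp (ad Z)
  ad_skew : ∀ X Y, ad X Y = -ad Y X
  jacobi : ∀ X Y Z, ad (ad X Y) Z = ad X (ad Y Z) - ad Y (ad X Z)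
  B_symm : ∀ X Y, B X Y = B Y X
  B_pos : ∀ X, X ≠ 0 → 0 < B X X
  B_Ad : ∀ g X Y, B (Ad g X) (Ad g Y) = B X Y
  B_ad : ∀ Z X Y, B (ad Z X) Y = -B X (ad Z Y)
  irreducible : ∀ W : Submodule ℝ V, (∀ X ∈ W, T X = -X) → (∀ k ∈ K, ∀ X ∈ W, Ad k X ∈ W) →
    W = ⊥ ∨ ∀ X, T X = -X → X ∈ W

/-- A maximal Abelian subspace of `𝔪` and a root vector `Z + iY` of the restricted root `α`. -/
structure RootData {Γ V : Type*} [Group Γ] [TopologicalSpace Γ] [NormedAddCommGroup V]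
    [NormedSpace ℝ V] (D : IsotropyData Γ V) where
  /-- the maximal Abelian subspace -/
  a : Submodule ℝ V
  /-- the root -/
  α : V
  /-- the component of the root vector fixed by the involution -/
  Z : V
  /-- the component of the root vector in `𝔪` -/
  Y : V
  T_a : ∀ H ∈ a, D.T H = -H
  ad_a : ∀ H ∈ a, ∀ H' ∈ a, D.ad H H' = 0
  maximal : ∀ X, D.T X = -X → (∀ H ∈ a, D.ad H X = 0) → X ∈ a
  α_mem : α ∈ a
  α_ne : α ≠ 0
  Z_ne : Z ≠ 0
  Y_ne : Y ≠ 0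
  T_Z : D.T Z = Z
  T_Y : D.T Y = -Y
  ad_Z : ∀ H ∈ a, D.ad H Z = D.B α H • Y
  ad_Y : ∀ H ∈ a, D.ad H Y = -(D.B α H • Z)

/-- A solution of a linear differential equation with constant coefficients. -/
theorem exp_apply_eq_of_hasDerivAt {V : Type*} [NormedAddCommGroup V] [NormedSpace ℝ V]
    [FiniteDimensional ℝ V] {L : V →L[ℝ] V} {v : ℝ → V} (hv : ∀ t, HasDerivAt v (L (v t)) t)
    (t : ℝ) : NormedSpace.exp (t • L) (v 0) = v t := by
  have : CompleteSpace V := FiniteDimensional.complete ℝ V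
  have h1 : ∀ s, HasDerivAt (fun u : ℝ => NormedSpace.exp (u • -L) (v u)) 0 s := by
    intro s
    have h := (hasDerivAt_exp_smul_const (𝕂 := ℝ) (-L) s).clm_apply (hv s)
    convert! h using 1
    simp
  have h2 := is_const_of_deriv_eq_zero (fun s => (h1 s).differentiableAt) (fun s => (h1 s).deriv) 0 t
  simp only [zero_smul, NormedSpace.exp_zero] at h2
  have h3 : NormedSpace.exp (t • L) * NormedSpace.exp (t • -L) = 1 := by
    have hc : Commute (t • L) (t • -L) :=
      (((Commute.refl L).neg_right).smul_left t).smul_right t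
    let _ : NormedAlgebra ℚ (V →L[ℝ] V) := .restrictScalars ℚ ℝ _
    rw [← NormedSpace.exp_add_of_commute hc]
    simp
  have h4 := congrArg (fun S : V →L[ℝ] V => S (v t)) h3
  rw [one_apply_eq_self] at h2
  rw [h2]
  exact h4

namespace IsotropyData

variable {Γ V : Type*} [Group Γ] [TopologicalSpace Γ] [NormedAddCommGroup V]
    [NormedSpace ℝ V] (D : IsotropyData Γ V)

theorem ad_self (X : V) : D.ad X X = 0 := by
  have h : (2 : ℝ) • D.ad X X = 0 := by
    rw [two_smul]
    nth_rewrite 1 [D.ad_skew X X]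
    simp
  simpa using h

theorem Ad_inv_apply (g : Γ) (X : V) : D.Ad g⁻¹ (D.Ad g X) = X := by
  have := congrArg (fun L : V →L[ℝ] V => L X) (D.Ad_mul g⁻¹ g)
  simpa [D.Ad_one] using this.symm

theorem Ad_apply_inv (g : Γ) (X : V) : D.Ad g (D.Ad g⁻¹ X) = X := by
  simpa using D.Ad_inv_apply g⁻¹ X

theorem Ad_mul_apply (g h : Γ) (X : V) : D.Ad (g * h) X = D.Ad g (D.Ad h X) := by
  rw [D.Ad_mul]; rfl

theorem eq_zero_of_B_self {X : V} (h : D.B X X = 0) : X = 0 := by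
  by_contra hX
  exact (D.B_pos X hX).ne' h

theorem exists_Ad_eq_exp_smul {Z : V} (hZ : D.T Z = Z) (t : ℝ) :
    ∃ k ∈ D.K, D.Ad k = NormedSpace.exp (t • D.ad Z) := by
  have := D.exists_Ad_eq_exp (t • Z) (by rw [map_smul, hZ])
  rwa [map_smul] at this

variable [FiniteDimensional ℝ V]

theorem exp_apply_of_ad_eq_zero {Z X : V} (h : D.ad Z X = 0) (t : ℝ) :
    NormedSpace.exp (t • D.ad Z) X = X :=
  exp_apply_eq_of_hasDerivAt (v := fun _ => X) (fun t => by rw [h]; exact hasDerivAt_const t X) t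

theorem hasDerivAt_exp_apply (Z X : V) :
    HasDerivAt (fun t : ℝ => NormedSpace.exp (t • D.ad Z) X) (D.ad Z X) 0 := by
  have : CompleteSpace V := FiniteDimensional.complete ℝ V
  have h := (hasDerivAt_exp_smul_const (𝕂 := ℝ) (D.ad Z) 0).clm_apply (hasDerivAt_const 0 X)
  simpa using h

/-- An element of `𝔪` can be moved into the centralizer of `H ∈ 𝔪` by an element of the isotropy
group which fixes a given set of commuting elements. -/
theorem exists_Ad_commute {ξ H : V} {s : Set V} (hξ : D.T ξ = -ξ) (hH : D.T H = -H)
    (hsξ : ∀ X ∈ s, D.ad ξ X = 0) (hsH : ∀ X ∈ s, D.ad H X = 0) :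
    ∃ k ∈ D.K, (∀ X ∈ s, D.Ad k X = X) ∧ D.ad (D.Ad k ξ) H = 0 := by
  have happ : ∀ X, Continuous fun k => D.Ad k X := fun X => D.continuous_Ad.clm_apply continuous_const
  have hcl : IsClosed {k | ∀ X ∈ s, D.Ad k X = X} := by
    simp only [ofPred_forall]
    exact isClosed_biInter fun X _ => isClosed_eq (happ X) continuous_const
  have hBc : Continuous fun X => D.B X H := (D.B.flip H).continuous_of_finiteDimensional
  -- The elements of K fixing `s` pointwise form a compact set; take a maximum of B(Ad(k)ξ, H)
  -- there.
  obtain ⟨k, ⟨hkK, hks⟩, hmax⟩ := (D.isCompact_K.inter_right hcl).exists_isMaxOn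
    ⟨1, D.K.one_mem, fun X _ => by rw [D.Ad_one]; rfl⟩
    (f := fun k => D.B (D.Ad k ξ) H) (hBc.comp (happ ξ)).continuousOn
  refine ⟨k, hkK, hks, ?_⟩
  set ξ' := D.Ad k ξ with hξ'
  have hsξ' : ∀ X ∈ s, D.ad ξ' X = 0 := by
    intro X hX
    have := D.Ad_ad k ξ X
    rw [hsξ X hX, map_zero, hks X hX] at this
    exact this.symm
  have hTξ' : D.T ξ' = -ξ' := by rw [hξ', D.T_Ad k hkK, hξ, map_neg]
  set Z := D.ad ξ' H with hZ
  have hTZ : D.T Z = Z := by rw [hZ, D.T_ad, hTξ', hH]; simp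
  -- By Jacobi, Z = [ξ', H] commutes with `s`, so exp(t ad Z) only produces admissible competitors.
  have hZs : ∀ X ∈ s, D.ad Z X = 0 := by
    intro X hX
    rw [hZ, D.jacobi, hsH X hX, hsξ' X hX, map_zero, map_zero, sub_zero]
  have hder : HasDerivAt (fun t : ℝ => D.B (NormedSpace.exp (t • D.ad Z) ξ') H)
      (D.B (D.ad Z ξ') H) 0 :=
    ((LinearMap.toContinuousLinearMap (D.B.flip H)).hasFDerivAt.comp_hasDerivAt (0 : ℝ)
      (D.hasDerivAt_exp_apply Z ξ') :)
  have hloc : IsLocalMax (fun t : ℝ => D.B (NormedSpace.exp (t • D.ad Z) ξ') H) 0 := by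
    refine Filter.Eventually.of_forall fun t => ?_
    obtain ⟨l, hl, hle⟩ := D.exists_Ad_eq_exp_smul hTZ t
    have h := hmax (a := l * k) ⟨D.K.mul_mem hl hkK, fun X hX => by
      rw [D.Ad_mul_apply, hks X hX, hle, D.exp_apply_of_ad_eq_zero (hZs X hX)]⟩
    simp only [mem_ofPred_eq, D.Ad_mul_apply, hle] at h
    simpa using h
  have h0 := hloc.hasDerivAt_eq_zero hder
  -- By skewness the derivative at the maximum is B(Z, Z), hence Z = 0.
  rw [D.ad_skew, map_neg, LinearMap.neg_apply, D.B_ad, neg_neg] at h0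
  exact D.eq_zero_of_B_self h0

end IsotropyData

namespace RootData

variable {Γ V : Type*} [Group Γ] [TopologicalSpace Γ] [NormedAddCommGroup V]
    [NormedSpace ℝ V] {D : IsotropyData Γ V} (R : RootData D)

theorem B_α_pos : 0 < D.B R.α R.α := D.B_pos _ R.α_ne

/-- The bracket lies in 𝔪 and commutes with 𝔞 by Jacobi, so it lies in 𝔞 by maximality. It is then
determined by its products with elements of 𝔞. -/
theorem ad_Z_Y : D.ad R.Z R.Y = D.B R.Z R.Z • R.α := by
  have h1 : D.ad R.Z R.Y ∈ R.a := by
    refine R.maximal _ ?_ fun H hH => ?_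
    · rw [D.T_ad, R.T_Z, R.T_Y, map_neg]
    · have h := D.jacobi H R.Z R.Y
      rw [R.ad_Z H hH, R.ad_Y H hH] at h
      simp only [map_smul, map_neg, smul_apply, D.ad_self, smul_zero, neg_zero, sub_zero] at h
      exact h.symm
  have h2 : ∀ H ∈ R.a, D.B (D.ad R.Z R.Y - D.B R.Z R.Z • R.α) H = 0 := by
    intro H hH
    have h3 : D.B (D.ad R.Z R.Y) H = D.B R.α H * D.B R.Z R.Z := by
      rw [D.ad_skew, map_neg, LinearMap.neg_apply, D.B_ad, neg_neg, D.ad_skew, R.ad_Y H hH]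
      simp
    simp only [map_sub, map_smul, LinearMap.sub_apply, LinearMap.smul_apply, h3, smul_eq_mul]
    ring
  have h3 := h2 _ (R.a.sub_mem h1 (R.a.smul_mem (D.B R.Z R.Z) R.α_mem))
  exact sub_eq_zero.1 (D.eq_zero_of_B_self h3)

theorem ad_Z_α : D.ad R.Z R.α = -(D.B R.α R.α • R.Y) := by
  rw [D.ad_skew, R.ad_Z _ R.α_mem]

/-- Elements of `𝔪` commuting with `α` are conjugate into `𝔞` under the stabilizer of `α`. -/
theorem exists_Ad_mem [FiniteDimensional ℝ V] {ξ : V} (hξ : D.T ξ = -ξ) (hαξ : D.ad R.α ξ = 0) :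
    ∃ k ∈ D.K, D.Ad k R.α = R.α ∧ D.Ad k ξ ∈ R.a := by
  obtain ⟨s, hs⟩ := IsNoetherian.noetherian R.a
  have hsa : ∀ H ∈ s, H ∈ R.a := fun H hH => hs ▸ Submodule.subset_span hH
  -- Generators of 𝔞 are treated one at a time. Keeping α and the earlier generators fixed preserves
  -- the relations already obtained.
  have key : ∀ s : Finset V, (∀ H ∈ s, H ∈ R.a) →
      ∃ k ∈ D.K, D.Ad k R.α = R.α ∧ ∀ H ∈ s, D.ad (D.Ad k ξ) H = 0 := by
    classical
    intro s
    induction s using Finset.induction_on with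
    | empty => exact fun _ => ⟨1, D.K.one_mem, by simp [D.Ad_one], by simp⟩
    | insert H s _ ih =>
      intro hs
      obtain ⟨k, hk, hkα, hks⟩ := ih fun X hX => hs X (Finset.mem_insert_of_mem hX)
      have hξα : D.ad (D.Ad k ξ) R.α = 0 := by
        have := D.Ad_ad k R.α ξ
        rw [hαξ, map_zero, hkα, D.ad_skew] at this
        exact neg_eq_zero.1 this.symm
      have hH := hs H (Finset.mem_insert_self _ _)
      obtain ⟨l, hl, hls, hlH⟩ := D.exists_Ad_commute (ξ := D.Ad k ξ) (H := H)
        (s := insert R.α (s : Set V)) (by rw [D.T_Ad k hk, hξ, map_neg]) (R.T_a H hH)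
        (by rintro X (rfl | hX); exacts [hξα, hks X hX])
        (by
          rintro X (rfl | hX)
          exacts [R.ad_a _ hH _ R.α_mem, R.ad_a _ hH _ (hs X (Finset.mem_insert_of_mem hX))])
      refine ⟨l * k, D.K.mul_mem hl hk, by rw [D.Ad_mul_apply, hkα, hls _ (mem_insert _ _)], ?_⟩
      intro X hX
      rw [D.Ad_mul_apply]
      rcases Finset.mem_insert.1 hX with rfl | hX
      · exact hlH
      · have := D.Ad_ad l (D.Ad k ξ) X
        rw [hks X hX, map_zero, hls X (mem_insert_of_mem _ hX)] at this
        exact this.symm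
  obtain ⟨k, hk, hkα, hks⟩ := key s hsa
  refine ⟨k, hk, hkα, R.maximal _ (by rw [D.T_Ad k hk, hξ, map_neg]) fun H hH => ?_⟩
  rw [← hs] at hH
  have hle : Submodule.span ℝ (s : Set V) ≤ LinearMap.ker (D.ad (D.Ad k ξ)).toLinearMap :=
    Submodule.span_le.2 fun X hX => hks X hX
  rw [D.ad_skew, neg_eq_zero]
  exact hle hH

/-- The centre meets `𝔪` trivially. -/
theorem eq_zero_of_ad_eq_zero (R : RootData D) {ξ : V} (hξ : D.T ξ = -ξ) (h : D.ad ξ = 0) : ξ = 0 := by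
  -- The centre intersected with 𝔪 is K-invariant. It cannot be all of 𝔪, since α is not central:
  -- [α, Z] = |α|²Y ≠ 0.
  let W : Submodule ℝ V := LinearMap.ker D.ad.toLinearMap ⊓ LinearMap.ker (D.T + 1).toLinearMap
  have hW : ∀ X, X ∈ W ↔ D.ad X = 0 ∧ D.T X = -X := by
    intro X
    simp [W, Submodule.mem_inf, add_eq_zero_iff_eq_neg]
  rcases D.irreducible W (fun X hX => ((hW X).1 hX).2) (fun k hk X hX => by
    rw [hW] at hX ⊢
    refine ⟨?_, by rw [D.T_Ad k hk, hX.2, map_neg]⟩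
    ext Y
    rw [← D.Ad_apply_inv k Y, ← D.Ad_ad, hX.1]
    simp) with h1 | h1
  · have := (hW ξ).2 ⟨h, hξ⟩
    rwa [h1, Submodule.mem_bot] at this
  · have h2 := ((hW _).1 (h1 R.α (R.T_a _ R.α_mem))).1
    have h3 := R.ad_Z _ R.α_mem
    rw [h2, zero_apply] at h3
    rcases smul_eq_zero.1 h3.symm with h4 | h4
    exacts [absurd h4 R.B_α_pos.ne', absurd h4 R.Y_ne]

/-- The orbit of `α`. -/
def orbit : Set V := {X | ∃ k ∈ D.K, X = D.Ad k R.α}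

/-- Near `α`, the orbit of `α` meets the centralizer of `α` only in `α`. -/
theorem exists_forall_norm_lt_eq_zero [FiniteDimensional ℝ V] :
    ∃ ε > 0, ∀ ξ, ‖ξ‖ < ε → D.T ξ = -ξ → D.ad R.α ξ = 0 → R.α + ξ ∈ R.orbit → ξ = 0 := by
  have : FiniteDimensional ℝ (V →L[ℝ] V) := inferInstance
  have hp := minpoly.ne_zero (IsIntegral.of_finite ℝ (D.ad R.α))
  obtain ⟨q, hq, h1⟩ := exists_aeval_sub_eq_zero hp (V →L[ℝ] V)
  obtain ⟨ε, hε, h2⟩ := exists_forall_norm_lt_pow_eq_zero (V := V) hq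
  have h3 : ∀ᶠ ξ in 𝓝 (0 : V), ‖D.ad ξ‖ < ε := by
    have : Tendsto (fun ξ => ‖D.ad ξ‖) (𝓝 0) (𝓝 0) := by
      have := (D.ad.continuous.norm).tendsto 0
      simpa using this
    exact this.eventually (gt_mem_nhds hε)
  obtain ⟨δ, hδ, h4⟩ := Metric.eventually_nhds_iff.1 h3
  refine ⟨δ, hδ, fun ξ hξδ hξ hαξ ⟨k, hk, hkξ⟩ => R.eq_zero_of_ad_eq_zero hξ ?_⟩
  have hconj : D.ad (R.α + ξ) = D.Ad k * D.ad R.α * D.Ad k⁻¹ := by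
    ext X
    rw [hkξ]
    simp [mul_apply_eq_comp, D.Ad_ad, D.Ad_apply_inv]
  -- By Jacobi, the commutator of these operators is ad [α, α + ξ] = 0.
  have hcomm : Commute (D.ad R.α) (D.ad (R.α + ξ)) := by
    ext X
    have h := D.jacobi R.α (R.α + ξ) X
    rw [map_add, D.ad_self, hαξ, zero_add, map_zero, zero_apply] at h
    exact sub_eq_zero.1 h.symm
  have hroot : Polynomial.aeval (D.ad (R.α + ξ)) (minpoly ℝ (D.ad R.α)) = 0 := by
    let u : (V →L[ℝ] V)ˣ := ⟨D.Ad k, D.Ad k⁻¹, by rw [← D.Ad_mul, mul_inv_cancel, D.Ad_one],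
      by rw [← D.Ad_mul, inv_mul_cancel, D.Ad_one]⟩
    have h := aeval_units_conj u (D.ad R.α) (minpoly ℝ (D.ad R.α))
    rw [minpoly.aeval, mul_zero, zero_mul] at h
    rw [hconj]
    exact h
  have h5 := h1 _ _ hcomm (minpoly.aeval _ _) hroot
  rw [map_add, add_sub_cancel_left] at h5
  obtain ⟨m, hm⟩ := h2 _ (h4 (by simpa using hξδ)) h5
  exact eq_zero_of_pow_eq_zero_of_skew D.B_pos (D.B_ad ξ) hm

/-- The root reflection is induced by an element of the isotropy group. -/
theorem exists_Ad_eq_reflection [FiniteDimensional ℝ V] :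
    ∃ k ∈ D.K, ∀ X ∈ R.a, D.Ad k X = X - (2 * D.B R.α X / D.B R.α R.α) • R.α := by
  have hα := R.B_α_pos
  have hZ := D.B_pos _ R.Z_ne
  -- This is the angular speed of ad Z in the plane of α and Y; time π/w is half a turn.
  set w := √(D.B R.α R.α * D.B R.Z R.Z) with hw
  have hw2 : w * w = D.B R.α R.α * D.B R.Z R.Z := Real.mul_self_sqrt (by positivity)
  have hwpos : 0 < w := Real.sqrt_pos.2 (by positivity)
  obtain ⟨k, hk, hke⟩ := D.exists_Ad_eq_exp_smul R.T_Z (Real.pi / w)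
  have hrot : D.Ad k R.α = -R.α := by
    have h1 : ∀ t, HasDerivAt (fun t : ℝ => Real.cos (w * t) • R.α -
        (D.B R.α R.α / w * Real.sin (w * t)) • R.Y)
        (D.ad R.Z (Real.cos (w * t) • R.α - (D.B R.α R.α / w * Real.sin (w * t)) • R.Y)) t := by
      intro t
      have hl : HasDerivAt (fun t : ℝ => w * t) w t := by
        simpa using (hasDerivAt_id t).const_mul w
      have h2 := (hl.cos.smul_const R.α).sub ((hl.sin.const_mul (D.B R.α R.α / w)).smul_const R.Y)
      convert! h2 using 1
      rw [map_sub, map_smul, map_smul, R.ad_Z_α, R.ad_Z_Y]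
      have e1 : D.B R.α R.α / w * (Real.cos (w * t) * w) = D.B R.α R.α * Real.cos (w * t) := by
        field_simp
      have e2 : D.B R.α R.α / w * Real.sin (w * t) * D.B R.Z R.Z = Real.sin (w * t) * w := by
        field_simp
        linear_combination (-Real.sin (w * t)) * hw2
      rw [e1, smul_smul, e2]
      module
    have h2 := exp_apply_eq_of_hasDerivAt h1 (Real.pi / w)
    have e3 : w * (Real.pi / w) = Real.pi := by field_simp
    rw [e3] at h2
    simpa [hke] using h2
  refine ⟨k, hk, fun X hX => ?_⟩
  -- The component X - cα is orthogonal to α, so Z commutes with it and the rotation fixes it.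
  set c := D.B R.α X / D.B R.α R.α with hc
  have hX' : D.Ad k (X - c • R.α) = X - c • R.α := by
    rw [hke]
    apply D.exp_apply_of_ad_eq_zero
    rw [D.ad_skew, R.ad_Z _ (R.a.sub_mem hX (R.a.smul_mem c R.α_mem))]
    have : D.B R.α (X - c • R.α) = 0 := by
      rw [map_sub, map_smul, smul_eq_mul, hc]
      field_simp
      simp
    rw [this, zero_smul, neg_zero]
  rw [map_sub, map_smul, hrot] at hX'
  have : D.Ad k X = X - c • R.α + c • -R.α := by rw [← hX']; abel
  rw [this, mul_div_assoc, ← hc]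
  module

end RootData

end Isotropy

/-! ### The orbit as an embedded submanifold, its tangent and normal spaces. -/

section Slice

namespace RootData

variable {Γ V : Type*} [Group Γ] [TopologicalSpace Γ] [NormedAddCommGroup V]
    [NormedSpace ℝ V] {D : IsotropyData Γ V} (R : RootData D)

theorem T_orbit {X : V} (hX : X ∈ R.orbit) : D.T X = -X := by
  obtain ⟨k, hk, rfl⟩ := hX
  rw [D.T_Ad k hk, R.T_a _ R.α_mem, map_neg]

theorem Ad_mem_orbit {k : Γ} (hk : k ∈ D.K) {X : V} (hX : X ∈ R.orbit) : D.Ad k X ∈ R.orbit := by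
  obtain ⟨l, hl, rfl⟩ := hX
  exact ⟨k * l, D.K.mul_mem hk hl, (D.Ad_mul_apply _ _ _).symm⟩

theorem α_mem_orbit : R.α ∈ R.orbit := ⟨1, D.K.one_mem, by rw [D.Ad_one]; rfl⟩

/-- The map `Z ↦ [Z, α]`, on the fixed points of the involution. -/
def infinitesimalAction : V →ₗ[ℝ] V :=
  ((D.ad.flip R.α).toLinearMap) ∘ₗ ((1 / 2 : ℝ) • (LinearMap.id + D.T.toLinearMap))

theorem infinitesimalAction_apply (X : V) :
    R.infinitesimalAction X = D.ad ((1 / 2 : ℝ) • (X + D.T X)) R.α := by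
  simp [infinitesimalAction]

theorem T_half_add (X : V) :
    D.T ((1 / 2 : ℝ) • (X + D.T X)) = (1 / 2 : ℝ) • (X + D.T X) := by
  rw [map_smul, map_add, D.T_T, add_comm]

theorem infinitesimalAction_apply_of_fixed {Z : V} (hZ : D.T Z = Z) :
    R.infinitesimalAction Z = D.ad Z R.α := by
  rw [infinitesimalAction_apply, hZ, ← two_smul ℝ Z, smul_smul]
  norm_num

/-- The tangent space `[𝔨, α]` of the orbit at `α`. -/
def tangent : Submodule ℝ V := LinearMap.range R.infinitesimalAction

/-- The normal vectors of the orbit in `𝔪` are the vectors commuting with `α`. -/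
theorem ad_eq_zero_of_orthogonal {ξ : V} (hξ : D.T ξ = -ξ)
    (h : ∀ Z, D.T Z = Z → D.B (D.ad Z R.α) ξ = 0) : D.ad R.α ξ = 0 := by
  -- The vector [α, ξ] is fixed by the involution and serves as its own test vector: B([[α, ξ], α],
  -- ξ) is its squared length.
  have hT : D.T (D.ad R.α ξ) = D.ad R.α ξ := by
    rw [D.T_ad, R.T_a _ R.α_mem, hξ]; simp
  have := h _ hT
  rw [D.ad_skew, map_neg, LinearMap.neg_apply, D.B_ad, neg_neg] at this
  exact D.eq_zero_of_B_self this

theorem B_eq_zero_of_mem_tangent {ξ : V} (h : D.ad R.α ξ = 0) {X : V} (hX : X ∈ R.tangent) :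
    D.B X ξ = 0 := by
  obtain ⟨Z, rfl⟩ := hX
  rw [infinitesimalAction_apply, D.ad_skew, map_neg, LinearMap.neg_apply, D.B_ad, h]
  simp

/-- The hypersphere of `𝔪` through `α`. -/
def sphere : Set V := {X | D.T X = -X ∧ D.B X X = D.B R.α R.α}

/-- The curve is a great circle with w = |ξ|/|α|. The zero vector is treated apart because the
parametrization divides by w. -/
theorem mem_tangentVectors_sphere {ξ : V} (hξ : D.T ξ = -ξ) (h : D.B R.α ξ = 0) :
    ξ ∈ tangentVectors R.sphere R.α := by
  have hα := R.B_α_pos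
  rcases eq_or_ne ξ 0 with rfl | hne
  · exact ⟨fun _ => ⟨R.α, R.T_a _ R.α_mem, rfl⟩, contDiff_const, rfl, by simp [velocity]⟩
  have hpos := D.B_pos _ hne
  set w := √(D.B ξ ξ / D.B R.α R.α) with hw
  have hw2 : w ^ 2 = D.B ξ ξ / D.B R.α R.α := Real.sq_sqrt (by positivity)
  have hwpos : 0 < w := Real.sqrt_pos.2 (by positivity)
  refine ⟨fun t => ⟨Real.cos (w * t) • R.α + (Real.sin (w * t) / w) • ξ, ?_, ?_⟩, ?_, ?_, ?_⟩
  · rw [map_add, map_smul, map_smul, R.T_a _ R.α_mem, hξ, neg_add, smul_neg, smul_neg]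
  · simp only [map_add, map_smul, LinearMap.add_apply, LinearMap.smul_apply, h,
      D.B_symm ξ R.α, smul_eq_mul]
    have e : D.B ξ ξ = w ^ 2 * D.B R.α R.α := by rw [hw2]; field_simp
    rw [e]
    have e2 : Real.sin (w * t) / w * (Real.sin (w * t) / w * (w ^ 2 * D.B R.α R.α)) =
        Real.sin (w * t) ^ 2 * D.B R.α R.α := by field_simp
    linear_combination e2 + (D.B R.α R.α) * Real.cos_sq_add_sin_sq (w * t)
  · have hl : ContDiff ℝ ∞ fun t : ℝ => w * t := contDiff_const.mul contDiff_id
    exact ((Real.contDiff_cos.comp hl).smul contDiff_const).add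
      (((Real.contDiff_sin.comp hl).div_const w).smul contDiff_const)
  · simp
  · have hl : HasDerivAt (fun t : ℝ => w * t) w 0 := by
      simpa using (hasDerivAt_id (0 : ℝ)).const_mul w
    have h2 := (hl.cos.smul_const R.α).add ((hl.sin.div_const w).smul_const ξ)
    refine h2.deriv.trans ?_
    simp [hwpos.ne']

variable [FiniteDimensional ℝ V]

/-- The orthogonal projection to the tangent space of the orbit and a section of the
infinitesimal action. -/
theorem exists_projection : ∃ P L : V →L[ℝ] V, (∀ v, P v ∈ R.tangent) ∧
    (∀ v ∈ R.tangent, P v = v) ∧ (∀ v, ∀ w ∈ R.tangent, D.B w (v - P v) = 0) ∧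
    (∀ v, D.T (L v) = L v) ∧ ∀ v, D.ad (L v) R.α = P v := by
  have hrefl : D.B.IsRefl := fun X Y h => by rwa [D.B_symm]
  have hcompl : IsCompl R.tangent (D.B.orthogonal R.tangent) := by
    rw [LinearMap.BilinForm.isCompl_orthogonal_iff_disjoint hrefl, Submodule.disjoint_def]
    intro X hX hX'
    exact D.eq_zero_of_B_self (hX' X hX)
  obtain ⟨g, hg⟩ := R.infinitesimalAction.rangeRestrict.exists_rightInverse_of_surjective
    R.infinitesimalAction.range_rangeRestrict
  have hg' : ∀ w : R.tangent, R.infinitesimalAction (g w) = w := fun w =>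
    congrArg Subtype.val (congrArg (fun l => l w) hg)
  -- `P` is the orthogonal projection. `L` is a linear section averaged with the involution;
  -- averaging makes its values fixed and leaves their infinitesimal action unchanged.
  refine ⟨LinearMap.toContinuousLinearMap (Submodule.projection _ _ hcompl), LinearMap.toContinuousLinearMap
    (((1 / 2 : ℝ) • (LinearMap.id + D.T.toLinearMap)) ∘ₗ
      g ∘ₗ Submodule.projectionOnto _ _ hcompl), ?_, ?_, ?_, ?_, ?_⟩
  · exact fun v => Submodule.projection_apply_mem hcompl v
  · exact fun v hv => Submodule.projection_apply_of_mem_left hcompl hv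
  · intro v w hw
    have : v - (Submodule.projection _ _ hcompl) v ∈ D.B.orthogonal R.tangent := by
      rw [← Submodule.projection_apply_eq_zero_iff hcompl, map_sub, sub_eq_zero]
      exact (Submodule.projection_apply_of_mem_left hcompl
        (Submodule.projection_apply_mem hcompl v)).symm
    exact this w hw
  · intro v
    exact T_half_add _
  · intro v
    have := hg' (Submodule.projectionOnto _ _ hcompl v)
    rw [infinitesimalAction_apply] at this
    exact this

/-- A submanifold chart of the orbit at `α`. -/
theorem exists_chart : ∃ φ : OpenPartialHomeomorph V V, R.α ∈ φ.source ∧ φ R.α = 0 ∧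
    ContDiffOn ℝ ∞ φ φ.source ∧ ContDiffOn ℝ ∞ φ.symm φ.target ∧
    HasFDerivAt φ.symm (ContinuousLinearMap.id ℝ V) 0 ∧
    φ '' (φ.source ∩ R.orbit) = φ.target ∩ (R.tangent : Set V) := by
  have : CompleteSpace V := FiniteDimensional.complete ℝ V
  obtain ⟨P, L, hPm, hPid, hPo, hLT, hLα⟩ := R.exists_projection
  -- The tangential part of v moves along the orbit through the exponential; the normal part
  -- displaces α linearly.
  let F : V → V := fun v => NormedSpace.exp (D.ad (L v)) (R.α + (v - P v))
  have hexp : ContDiff ℝ ∞ (NormedSpace.exp : (V →L[ℝ] V) → V →L[ℝ] V) :=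
    contDiff_iff_contDiffAt.2 fun S => (NormedSpace.exp_analytic (𝕂 := ℝ) S).contDiffAt
  have hF : ContDiff ℝ ∞ F :=
    (hexp.comp (D.ad.contDiff.comp L.contDiff)).clm_apply
      (contDiff_const.add (contDiff_id.sub P.contDiff))
  have hF0 : F 0 = R.α := by simp [F, NormedSpace.exp_zero]
  -- The derivative at 0 sends v to [Lv, α] + (v - Pv) = Pv + (v - Pv) = v.
  have hF' : HasFDerivAt F (ContinuousLinearEquiv.refl ℝ V : V →L[ℝ] V) 0 := by
    have h1 : HasFDerivAt (fun v => D.ad (L v)) (D.ad.comp L) 0 := (D.ad.comp L).hasFDerivAt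
    have h2 : HasFDerivAt (NormedSpace.exp : (V →L[ℝ] V) → V →L[ℝ] V)
        (1 : (V →L[ℝ] V) →L[ℝ] V →L[ℝ] V) (D.ad (L 0)) := by
      rw [map_zero, map_zero]; exact hasFDerivAt_exp_zero
    have h3 : HasFDerivAt (fun v => R.α + (v - P v)) (ContinuousLinearMap.id ℝ V - P) 0 :=
      ((hasFDerivAt_id 0).sub P.hasFDerivAt).const_add _
    have h4 := (h2.comp 0 h1).clm_apply h3
    convert! h4 using 1
    ext v
    simp [NormedSpace.exp_zero, hLα]
  obtain ⟨ε, hε, hgap⟩ := R.exists_forall_norm_lt_eq_zero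
  -- The exponential factor comes from K, so F v lies in the orbit exactly when α + (v - Pv) does.
  -- That displacement commutes with α, and isolation of α forces it to vanish.
  have hFm : ∀ v, ‖v - P v‖ < ε → (F v ∈ R.orbit ↔ v ∈ R.tangent) := by
    intro v hv
    obtain ⟨k, hk, hke⟩ := D.exists_Ad_eq_exp (L v) (hLT v)
    have hFv : F v = D.Ad k (R.α + (v - P v)) := by rw [hke]
    constructor
    · intro h
      have h1 : R.α + (v - P v) ∈ R.orbit := by
        have := R.Ad_mem_orbit (D.K.inv_mem hk) h
        rwa [hFv, D.Ad_inv_apply] at this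
      have h2 : D.T (v - P v) = -(v - P v) := by
        have := R.T_orbit h1
        rw [map_add, R.T_a _ R.α_mem, neg_add] at this
        exact add_left_cancel this
      have h3 := R.ad_eq_zero_of_orthogonal h2 fun Z hZ => hPo v _
        ⟨Z, R.infinitesimalAction_apply_of_fixed hZ⟩
      rw [sub_eq_zero.1 (hgap _ hv h2 h3 h1)]
      exact hPm v
    · intro h
      rw [hFv, hPid v h, sub_self, add_zero]
      exact ⟨k, hk, rfl⟩
  -- Shrinking to where the derivative of F is invertible makes the inverse smooth on its whole
  -- domain, not only at one point.
  have hinv : ∀ᶠ v in 𝓝 (0 : V), ∃ e : V ≃L[ℝ] V, (e : V →L[ℝ] V) = fderiv ℝ F v := by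
    have hc : Continuous (fderiv ℝ F) := hF.continuous_fderiv (by simp)
    exact hc.continuousAt.eventually
      (ContinuousLinearEquiv.isOpen.mem_nhds ⟨ContinuousLinearEquiv.refl ℝ V, hF'.fderiv.symm⟩)
  have hsmall : ∀ᶠ v in 𝓝 (0 : V), ‖v - P v‖ < ε := by
    have hc : Continuous fun v => ‖v - P v‖ := by fun_prop
    exact hc.continuousAt.eventually (gt_mem_nhds (by simpa using hε))
  obtain ⟨O, hO, hOo, h0O⟩ := eventually_nhds_iff.1 (hinv.and hsmall)
  let φ₀ := (hF.contDiffAt (x := 0)).toOpenPartialHomeomorph F hF' (by simp)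
  have hφ₀ : (φ₀ : V → V) = F := rfl
  have h0φ : (0 : V) ∈ φ₀.source :=
    (hF.contDiffAt (x := 0)).mem_toOpenPartialHomeomorph_source hF' (by simp)
  let φ₁ := φ₀.restrOpen O hOo
  have hs : φ₁.source = φ₀.source ∩ O := φ₀.restrOpen_source O hOo
  have hφ₁ : (φ₁ : V → V) = F := rfl
  have h0 : (0 : V) ∈ φ₁.source := by rw [hs]; exact ⟨h0φ, h0O⟩
  refine ⟨φ₁.symm, ?_, ?_, ?_, ?_, ?_, ?_⟩
  · rw [← hF0, ← hφ₁]
    exact φ₁.map_source h0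
  · rw [← hF0, ← hφ₁]
    exact φ₁.left_inv h0
  · intro y hy
    have hy' := φ₁.map_target hy
    rw [hs] at hy'
    obtain ⟨e, he⟩ := (hO _ hy'.2).1
    refine (φ₁.contDiffAt_symm hy (f₀' := e) ?_ hF.contDiffAt).contDiffWithinAt
    rw [he]
    exact ((hF.differentiable (by simp)) _).hasFDerivAt
  · exact hF.contDiffOn
  · exact hF'
  · ext v
    constructor
    · rintro ⟨x, ⟨hx, hxM⟩, rfl⟩
      have hy := φ₁.map_target hx
      refine ⟨hy, ?_⟩
      rw [hs] at hy
      refine (hFm _ (hO _ hy.2).2).1 ?_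
      have : F (φ₁.symm x) = x := φ₁.right_inv hx
      rwa [this]
    · rintro ⟨hv, hvW⟩
      have hv' : v ∈ φ₀.source ∩ O := by rw [← hs]; exact hv
      exact ⟨F v, ⟨φ₁.map_source hv, (hFm _ (hO _ hv'.2).2).2 hvW⟩, φ₁.left_inv hv⟩

/-- By homogeneity, composing the chart at α with Ad(k)⁻¹ gives a chart at Ad(k)α with the same
model subspace. -/
theorem isEmbeddedSubmanifold_orbit : IsEmbeddedSubmanifold R.orbit := by
  obtain ⟨φ, h1, -, h2, h3, -, h4⟩ := R.exists_chart
  refine ⟨R.tangent, ?_⟩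
  rintro x ⟨k, hk, rfl⟩
  let e : V ≃L[ℝ] V := ContinuousLinearEquiv.equivOfInverse (D.Ad k⁻¹) (D.Ad k)
    (D.Ad_apply_inv k) (D.Ad_inv_apply k)
  have he : ∀ X, e X = D.Ad k⁻¹ X := fun X => rfl
  have hes : ∀ X, e.symm X = D.Ad k X := fun X => rfl
  let ψ := e.toHomeomorph.transOpenPartialHomeomorph φ
  have hψ : (ψ : V → V) = φ ∘ e := rfl
  have hψs : (ψ.symm : V → V) = e.symm ∘ φ.symm := rfl
  have hsrc : ψ.source = e ⁻¹' φ.source := rfl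
  have htgt : ψ.target = φ.target := rfl
  refine ⟨ψ, ?_, ?_, ?_, ?_⟩
  · rw [hsrc, mem_preimage, he, D.Ad_inv_apply]
    exact h1
  · rw [hψ, hsrc]
    exact h2.comp e.contDiff.contDiffOn (mapsTo_preimage _ _)
  · rw [hψs, htgt]
    exact e.symm.contDiff.comp_contDiffOn h3
  · rw [htgt, ← h4, hψ, hsrc, image_comp]
    congr 1
    ext X
    constructor
    · rintro ⟨Y, ⟨hY, hYM⟩, rfl⟩
      exact ⟨hY, R.Ad_mem_orbit (D.K.inv_mem hk) hYM⟩
    · rintro ⟨hX, hXM⟩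
      exact ⟨e.symm X, ⟨by simpa using hX, R.Ad_mem_orbit hk hXM⟩, by simp⟩

/-- In the chart the curve runs in the model subspace, and the chart has identity differential at α.
-/
theorem tangentVectors_orbit_subset : tangentVectors R.orbit R.α ⊆ R.tangent := by
  rintro _ ⟨c, hc, hc0, rfl⟩
  obtain ⟨φ, h1, h1', h2, h3, hd, h4⟩ := R.exists_chart
  set γ : ℝ → V := fun t => (c t : V) with hγ
  have hγc : ContDiff ℝ ∞ γ := hc
  have hγ0 : γ 0 = R.α := hc0
  have hev : ∀ᶠ t in 𝓝 (0 : ℝ), γ t ∈ φ.source :=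
    hγc.continuous.continuousAt.eventually (φ.open_source.mem_nhds (by rwa [hγ0]))
  have hφd : DifferentiableAt ℝ φ (γ 0) := by
    rw [hγ0]
    exact (h2.contDiffAt (φ.open_source.mem_nhds h1)).differentiableAt (by simp)
  have hγd : HasDerivAt γ (velocity c 0) 0 :=
    ((hγc.differentiable (by simp)) 0).hasDerivAt
  have hu : HasDerivAt (φ ∘ γ) (fderiv ℝ φ (γ 0) (velocity c 0)) 0 :=
    hφd.hasFDerivAt.comp_hasDerivAt 0 hγd
  have hd' : HasFDerivAt φ.symm (ContinuousLinearMap.id ℝ V) ((φ ∘ γ) 0) := by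
    rw [Function.comp_apply, hγ0, h1']; exact hd
  have h5 := hd'.comp_hasDerivAt (0 : ℝ) hu
  have h6 : γ =ᶠ[𝓝 0] φ.symm ∘ φ ∘ γ := by
    filter_upwards [hev] with t ht
    exact (φ.left_inv ht).symm
  have h7 : fderiv ℝ φ (γ 0) (velocity c 0) = velocity c 0 :=
    (h5.congr_of_eventuallyEq h6).unique hγd
  rw [h7] at hu
  obtain ⟨P, -, hPm, hPid, -⟩ := R.exists_projection
  -- The projection P fixes the curve read in the chart near time 0, hence it fixes the velocity.
  have h8 : (fun t => P ((φ ∘ γ) t)) =ᶠ[𝓝 0] φ ∘ γ := by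
    filter_upwards [hev] with t ht
    have : φ (γ t) ∈ φ.target ∩ (R.tangent : Set V) := by
      rw [← h4]; exact ⟨γ t, ⟨ht, (c t).2⟩, rfl⟩
    exact hPid _ this.2
  have h9 := ((P.hasFDerivAt.comp_hasDerivAt (0 : ℝ) hu).congr_of_eventuallyEq h8.symm).unique hu
  rw [← h9]
  exact hPm _

theorem ad_mem_tangentVectors_orbit {Z : V} (hZ : D.T Z = Z) :
    D.ad Z R.α ∈ tangentVectors R.orbit R.α := by
  have : CompleteSpace V := FiniteDimensional.complete ℝ V
  refine ⟨fun t => ⟨NormedSpace.exp (t • D.ad Z) R.α, ?_⟩, ?_, ?_, ?_⟩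
  · obtain ⟨k, hk, hke⟩ := D.exists_Ad_eq_exp_smul hZ t
    exact ⟨k, hk, by rw [hke]⟩
  · have hexp : ContDiff ℝ ∞ (NormedSpace.exp : (V →L[ℝ] V) → V →L[ℝ] V) :=
      contDiff_iff_contDiffAt.2 fun S => (NormedSpace.exp_analytic (𝕂 := ℝ) S).contDiffAt
    exact (hexp.comp (contDiff_id.smul contDiff_const)).clm_apply contDiff_const
  · simp [NormedSpace.exp_zero]
  · exact (D.hasDerivAt_exp_apply Z R.α).deriv

theorem of_mem_tangentVectors_sphere {ξ : V} (h : ξ ∈ tangentVectors R.sphere R.α) :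
    D.T ξ = -ξ ∧ D.B R.α ξ = 0 := by
  obtain ⟨c, hc, hc0, rfl⟩ := h
  set γ : ℝ → V := fun t => (c t : V) with hγ
  have hγc : ContDiff ℝ ∞ γ := hc
  have hγd : HasDerivAt γ (velocity c 0) 0 :=
    ((hγc.differentiable (by simp)) 0).hasDerivAt
  constructor
  · have h1 : HasDerivAt (fun t => D.T (γ t)) (D.T (velocity c 0)) 0 :=
      D.T.hasFDerivAt.comp_hasDerivAt (0 : ℝ) hγd
    have h2 : (fun t => D.T (γ t)) = fun t => -γ t := funext fun t => (c t).2.1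
    rw [h2] at h1
    exact h1.unique hγd.neg
  · let B' : V →L[ℝ] V →L[ℝ] ℝ :=
      LinearMap.toContinuousLinearMap (LinearMap.toContinuousLinearMap.toLinearMap ∘ₗ D.B)
    have h2 := (B'.hasFDerivAt.comp_hasDerivAt (0 : ℝ) hγd).clm_apply hγd
    have h3 : (fun s => (B' ∘ γ) s (γ s)) = fun _ => D.B R.α R.α := funext fun t => (c t).2.2
    rw [h3] at h2
    have h4 := h2.unique (hasDerivAt_const (0 : ℝ) (D.B R.α R.α))
    have h5 : D.B (velocity c 0) (γ 0) + D.B (γ 0) (velocity c 0) = 0 := h4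
    have hγ0 : γ 0 = R.α := hc0
    rw [hγ0, D.B_symm (velocity c 0)] at h5
    linarith

theorem mem_normalVectors_iff {ξ : V} : ξ ∈ normalVectors D.B R.sphere R.orbit R.α ↔
    D.T ξ = -ξ ∧ D.B R.α ξ = 0 ∧ D.ad R.α ξ = 0 := by
  constructor
  · rintro ⟨h1, h2⟩
    obtain ⟨h3, h4⟩ := R.of_mem_tangentVectors_sphere h1
    exact ⟨h3, h4, R.ad_eq_zero_of_orthogonal h3 fun Z hZ => h2 _ (R.ad_mem_tangentVectors_orbit hZ)⟩
  · rintro ⟨h1, h2, h3⟩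
    exact ⟨R.mem_tangentVectors_sphere h1 h2, fun v hv =>
      R.B_eq_zero_of_mem_tangent h3 (R.tangentVectors_orbit_subset hv)⟩

end RootData
end Slice

/-! ### The isometries -Ad(g) and the reflections of the orbit. -/

section Reflections

theorem map_mem_tangentVectors {V : Type*} [NormedAddCommGroup V] [NormedSpace ℝ V] {M : Set V}
    (L : V →L[ℝ] V) (hL : ∀ y ∈ M, L y ∈ M) {x v : V} (hv : v ∈ tangentVectors M x) :
    L v ∈ tangentVectors M (L x) := by
  obtain ⟨c, hc, rfl, rfl⟩ := hv
  refine ⟨fun t => ⟨L (c t), hL _ (c t).2⟩, L.contDiff.comp hc, rfl, ?_⟩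
  have hc' : ContDiff ℝ ∞ fun t => (c t : V) := hc
  exact (L.hasFDerivAt.comp_hasDerivAt (0 : ℝ)
    ((hc'.differentiable (by simp)) 0).hasDerivAt).deriv

namespace RootData

variable {Γ V : Type*} [Group Γ] [TopologicalSpace Γ] [NormedAddCommGroup V]
    [NormedSpace ℝ V] {D : IsotropyData Γ V} (R : RootData D)

theorem Ad_mem_sphere {g : Γ} (hg : g ∈ D.K) {X : V} (hX : X ∈ R.sphere) :
    D.Ad g X ∈ R.sphere :=
  ⟨by rw [D.T_Ad g hg, hX.1, map_neg], by rw [D.B_Ad, hX.2]⟩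

theorem neg_mem_sphere {X : V} (hX : X ∈ R.sphere) : -X ∈ R.sphere :=
  ⟨by rw [map_neg, hX.1], by simp [hX.2]⟩

theorem orbit_subset_sphere : R.orbit ⊆ R.sphere := by
  rintro _ ⟨k, hk, rfl⟩
  exact R.Ad_mem_sphere hk ⟨R.T_a _ R.α_mem, rfl⟩

/-- The permutation `-Ad(g)` of the hypersphere. -/
def negAd (g : Γ) (hg : g ∈ D.K) : Equiv.Perm R.sphere where
  toFun x := ⟨-D.Ad g x, R.neg_mem_sphere (R.Ad_mem_sphere hg x.2)⟩
  invFun x := ⟨-D.Ad g⁻¹ x, R.neg_mem_sphere (R.Ad_mem_sphere (D.K.inv_mem hg) x.2)⟩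
  left_inv x := Subtype.ext (by simp [D.Ad_inv_apply])
  right_inv x := Subtype.ext (by simp [D.Ad_apply_inv])

theorem velocity_negAd {g : Γ} (hg : g ∈ D.K) {c : ℝ → R.sphere} (hc : IsSmoothCurve c) (t : ℝ) :
    velocity (fun s => R.negAd g hg (c s)) t = -D.Ad g (velocity c t) := by
  have hc' : ContDiff ℝ ∞ fun t => (c t : V) := hc
  exact ((D.Ad g).hasFDerivAt.comp_hasDerivAt t
    ((hc'.differentiable (by simp)) t).hasDerivAt).neg.deriv

theorem isRiemannianIsometry_negAd {g : Γ} (hg : g ∈ D.K) :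
    IsRiemannianIsometry D.B (R.negAd g hg) where
  smooth _ hc := ((D.Ad g).contDiff.comp hc).neg
  smooth_symm _ hc := ((D.Ad g⁻¹).contDiff.comp hc).neg
  speed c hc t := by rw [R.velocity_negAd hg hc]; simp [D.B_Ad]

/-- Since -Ad(g)Ad(k)α = Ad(gk)(-α), the single membership of -α suffices. -/
theorem neg_Ad_mem_orbit (hneg : -R.α ∈ R.orbit) {g : Γ} (hg : g ∈ D.K) {X : V}
    (hX : X ∈ R.orbit) : -D.Ad g X ∈ R.orbit := by
  obtain ⟨k, hk, rfl⟩ := hX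
  rw [← D.Ad_mul_apply, ← map_neg]
  exact R.Ad_mem_orbit (D.K.mul_mem hg hk) hneg

theorem isReflection_negAd (hneg : -R.α ∈ R.orbit) {g : Γ} (hg : g ∈ D.K) {x : R.sphere} {ξ : V}
    (hx : D.Ad g x = -x) (hξ : D.Ad g ξ = ξ) :
    IsReflection D.B R.orbit x ξ (R.negAd g hg) where
  isometry := R.isRiemannianIsometry_negAd hg
  fixes := Subtype.ext (by
    change -D.Ad g x = x
    rw [hx, neg_neg])
  differential c hc _ hcξ := by rw [R.velocity_negAd hg hc, hcξ, hξ]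
  image := by
    ext y
    constructor
    · rintro ⟨x, hx, rfl⟩
      exact R.neg_Ad_mem_orbit hneg hg hx
    · intro hy
      exact ⟨(R.negAd g hg).symm y, R.neg_Ad_mem_orbit hneg (D.K.inv_mem hg) hy,
        Equiv.apply_symm_apply _ _⟩

section

variable {k₀ : Γ} (hk : ∀ X ∈ R.a, D.Ad k₀ X = X - (2 * D.B R.α X / D.B R.α R.α) • R.α)
include hk

theorem Ad_α_of_reflection : D.Ad k₀ R.α = -R.α := by
  rw [hk _ R.α_mem, mul_div_assoc, div_self R.B_α_pos.ne', mul_one, two_smul]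
  abel

theorem Ad_of_reflection {ξ : V} (hξ : ξ ∈ R.a) (h : D.B R.α ξ = 0) : D.Ad k₀ ξ = ξ := by
  rw [hk _ hξ, h]
  simp

theorem image_of_reflection : D.Ad k₀ '' (R.a : Set V) = R.a := by
  have hmem : ∀ X ∈ R.a, D.Ad k₀ X ∈ R.a := fun X hX => by
    rw [hk X hX]
    exact R.a.sub_mem hX (R.a.smul_mem _ R.α_mem)
  -- Surjectivity holds because s_α is its own inverse.
  refine Subset.antisymm (image_subset_iff.2 hmem) fun X hX => ⟨_, hmem X hX, ?_⟩
  rw [hk X hX, map_sub, map_smul, R.Ad_α_of_reflection hk, hk X hX]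
  simp

theorem neg_α_mem_orbit (hkK : k₀ ∈ D.K) : -R.α ∈ R.orbit :=
  ⟨k₀, hkK, (R.Ad_α_of_reflection hk).symm⟩

variable [FiniteDimensional ℝ V]

/-- Conjugating the root reflection yields reflections for all normal vectors at `α`. -/
theorem exists_conj_fixes {ξ : V} (hξ : ξ ∈ normalVectors D.B R.sphere R.orbit R.α) :
    ∃ k₁ ∈ D.K, D.Ad k₁ R.α = R.α ∧ D.Ad k₁ ξ ∈ R.a ∧
      D.Ad (k₁⁻¹ * k₀ * k₁) R.α = -R.α ∧ D.Ad (k₁⁻¹ * k₀ * k₁) ξ = ξ := by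
  obtain ⟨h1, h2, h3⟩ := R.mem_normalVectors_iff.1 hξ
  obtain ⟨k₁, hk₁, hα, ha⟩ := R.exists_Ad_mem h1 h3
  refine ⟨k₁, hk₁, hα, ha, ?_, ?_⟩
  · have hα' := D.Ad_inv_apply k₁ R.α
    rw [hα] at hα'
    rw [D.Ad_mul_apply, D.Ad_mul_apply, hα, R.Ad_α_of_reflection hk, map_neg, hα']
  -- Since k₁ fixes α, the moved vector stays orthogonal to α, where the root reflection is the
  -- identity.
  · have : D.B R.α (D.Ad k₁ ξ) = 0 := by rw [← h2, ← D.B_Ad k₁ R.α ξ, hα]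
    rw [D.Ad_mul_apply, D.Ad_mul_apply, R.Ad_of_reflection hk ha this, D.Ad_inv_apply]

/-- A normal vector at Ad(k)α is carried to α by Ad(k)⁻¹; the reflection found there is conjugated
back by k. -/
theorem isWeaklyReflective_orbit (hkK : k₀ ∈ D.K) : IsWeaklyReflective D.B R.sphere R.orbit where
  subset := R.orbit_subset_sphere
  submanifold := R.isEmbeddedSubmanifold_orbit
  reflection := by
    rintro ⟨x, hxS⟩ hx ξ ⟨hξ1, hξ2⟩
    obtain ⟨k, hkk, rfl⟩ := hx
    have hξ : D.Ad k⁻¹ ξ ∈ normalVectors D.B R.sphere R.orbit R.α := by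
      constructor
      · have := map_mem_tangentVectors (D.Ad k⁻¹)
          (fun y hy => R.Ad_mem_sphere (D.K.inv_mem hkk) hy) hξ1
        simpa only [D.Ad_inv_apply] using this
      · intro v hv
        rw [← D.B_Ad k, D.Ad_apply_inv]
        exact hξ2 _ (map_mem_tangentVectors (D.Ad k) (fun y hy => R.Ad_mem_orbit hkk hy) hv)
    obtain ⟨k₁, hk₁, -, -, h1, h2⟩ := R.exists_conj_fixes hk hξ
    have hg : k * (k₁⁻¹ * k₀ * k₁) * k⁻¹ ∈ D.K := D.K.mul_mem (D.K.mul_mem hkk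
      (D.K.mul_mem (D.K.mul_mem (D.K.inv_mem hk₁) hkK) hk₁)) (D.K.inv_mem hkk)
    refine ⟨R.negAd _ hg, R.isReflection_negAd (R.neg_α_mem_orbit hk hkK) hg ?_ ?_⟩
    · rw [D.Ad_mul_apply, D.Ad_mul_apply k, D.Ad_inv_apply, h1, map_neg]
    · rw [D.Ad_mul_apply, D.Ad_mul_apply k, h2, D.Ad_apply_inv]

theorem exists_reflection (hkK : k₀ ∈ D.K) :
    ∃ (p : R.sphere) (σ : Equiv.Perm R.sphere), (p : V) = R.α ∧
      (∀ x, (σ x : V) = -D.Ad k₀ (x : V)) ∧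
      (∀ ξ ∈ R.a, D.B R.α ξ = 0 → ξ ∈ normalVectors D.B R.sphere R.orbit R.α ∧
        IsReflection D.B R.orbit p ξ σ) ∧
      ∀ ξ ∈ normalVectors D.B R.sphere R.orbit R.α,
        ∃ k₁ ∈ D.K, D.Ad k₁ R.α = R.α ∧ D.Ad k₁ ξ ∈ R.a ∧ ∃ τ : Equiv.Perm R.sphere,
          (∀ x, (τ x : V) = D.Ad k₁⁻¹ (-D.Ad k₀ (D.Ad k₁ (x : V)))) ∧
          IsReflection D.B R.orbit p ξ τ := by
  have hneg := R.neg_α_mem_orbit hk hkK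
  refine ⟨⟨R.α, R.orbit_subset_sphere R.α_mem_orbit⟩, R.negAd k₀ hkK, rfl, fun _ => rfl, ?_, ?_⟩
  · intro ξ hξ h
    exact ⟨R.mem_normalVectors_iff.2 ⟨R.T_a _ hξ, h, R.ad_a _ R.α_mem _ hξ⟩,
      R.isReflection_negAd hneg hkK (R.Ad_α_of_reflection hk) (R.Ad_of_reflection hk hξ h)⟩
  · intro ξ hξ
    obtain ⟨k₁, hk₁, h1, h2, h3, h4⟩ := R.exists_conj_fixes hk hξ
    have hg : k₁⁻¹ * k₀ * k₁ ∈ D.K :=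
      D.K.mul_mem (D.K.mul_mem (D.K.inv_mem hk₁) hkK) hk₁
    refine ⟨k₁, hk₁, h1, h2, R.negAd _ hg, fun x => ?_, R.isReflection_negAd hneg hg h3 h4⟩
    change -D.Ad (k₁⁻¹ * k₀ * k₁) x = _
    rw [D.Ad_mul_apply, D.Ad_mul_apply, map_neg]

end

end RootData
end Reflections

/-! ### From complex root vectors to the pair `Z`, `Y`. -/

section RestrictedRoots

/-- The components of a complex root vector with respect to the involution. -/
theorem IsotropyData.exists_root_vector {Γ V : Type*} [Group Γ] [TopologicalSpace Γ]
    [NormedAddCommGroup V] [NormedSpace ℝ V] (D : IsotropyData Γ V) {a : Submodule ℝ V} {α U W : V}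
    (hT : ∀ H ∈ a, D.T H = -H) (hα : α ∈ a) (hα0 : α ≠ 0) (hne : ¬(U = 0 ∧ W = 0))
    (hU : ∀ H ∈ a, D.ad H U = -(D.B α H • W)) (hW : ∀ H ∈ a, D.ad H W = D.B α H • U) :
    ∃ Z Y : V, Z ≠ 0 ∧ Y ≠ 0 ∧ D.T Z = Z ∧ D.T Y = -Y ∧ (∀ H ∈ a, D.ad H Z = D.B α H • Y) ∧
      ∀ H ∈ a, D.ad H Y = -(D.B α H • Z) := by
  have hαα := (D.B_pos α hα0).ne'
  -- Evaluating at H = α, where ⟨α, α⟩ ≠ 0, shows that each component vanishes only together with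
  -- the other.
  have key : ∀ Z Y : V, (Z ≠ 0 ∨ Y ≠ 0) → (∀ H ∈ a, D.ad H Z = D.B α H • Y) →
      (∀ H ∈ a, D.ad H Y = -(D.B α H • Z)) → Z ≠ 0 ∧ Y ≠ 0 := by
    intro Z Y h hZ hY
    have h1 : Z = 0 → Y = 0 := by
      rintro rfl
      have := hZ α hα
      rw [map_zero] at this
      exact (smul_eq_zero.1 this.symm).resolve_left hαα
    have h2 : Y = 0 → Z = 0 := by
      rintro rfl
      have := hY α hα
      rw [map_zero, eq_comm, neg_eq_zero] at this
      exact (smul_eq_zero.1 this).resolve_left hαα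
    tauto
  have hTU : ∀ H ∈ a, D.ad H (D.T U) = D.B α H • D.T W := by
    intro H hH
    have := congrArg D.T (hU H hH)
    rw [D.T_ad, hT H hH, map_neg, map_neg, map_smul] at this
    exact neg_injective this
  have hTW : ∀ H ∈ a, D.ad H (D.T W) = -(D.B α H • D.T U) := by
    intro H hH
    have := congrArg D.T (hW H hH)
    rw [D.T_ad, hT H hH, map_neg, map_smul] at this
    rw [← this]
    simp
  -- Symmetrizing U + iW under the involution gives two candidate pairs. If both vanished, U and W
  -- would be zero.
  by_cases h : U + D.T U ≠ 0 ∨ D.T W - W ≠ 0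
  · have hZ : ∀ H ∈ a, D.ad H (U + D.T U) = D.B α H • (D.T W - W) := fun H hH => by
      rw [map_add, hU H hH, hTU H hH]; module
    have hY : ∀ H ∈ a, D.ad H (D.T W - W) = -(D.B α H • (U + D.T U)) := fun H hH => by
      rw [map_sub, hW H hH, hTW H hH]; module
    obtain ⟨h1, h2⟩ := key _ _ h hZ hY
    exact ⟨_, _, h1, h2, by rw [map_add, D.T_T, add_comm], by rw [map_sub, D.T_T]; abel, hZ, hY⟩
  · have hZ : ∀ H ∈ a, D.ad H (W + D.T W) = D.B α H • (U - D.T U) := fun H hH => by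
      rw [map_add, hW H hH, hTW H hH]; module
    have hY : ∀ H ∈ a, D.ad H (U - D.T U) = -(D.B α H • (W + D.T W)) := fun H hH => by
      rw [map_sub, hU H hH, hTU H hH]; module
    have h' : W + D.T W ≠ 0 ∨ U - D.T U ≠ 0 := by
      by_contra h'
      push Not at h h'
      apply hne
      constructor
      · have : (2 : ℝ) • U = (U + D.T U) + (U - D.T U) := by module
        rw [h.1, h'.2, add_zero] at this
        exact (smul_eq_zero.1 this).resolve_left two_ne_zero
      · have : (2 : ℝ) • W = (W + D.T W) - (D.T W - W) := by module
        rw [h.2, h'.1, sub_zero] at this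
        exact (smul_eq_zero.1 this).resolve_left two_ne_zero
    obtain ⟨h1, h2⟩ := key _ _ h' hZ hY
    exact ⟨_, _, h1, h2, by rw [map_add, D.T_T, add_comm], by rw [map_sub, D.T_T]; abel, hZ, hY⟩

/-- The real and imaginary parts of a complex root vector. -/
theorem exists_re_im_of_root_vector {L : Type*} [LieRing L] [LieAlgebra ℝ L] {a : Submodule ℝ L}
    {b : L → ℝ} {X : ℂ ⊗[ℝ] L} (hX : X ≠ 0)
    (h : ∀ H ∈ a, ⁅(1 : ℂ) ⊗ₜ[ℝ] H, X⁆ = (Complex.I * (b H : ℂ)) • X) :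
    ∃ U W : L, ¬(U = 0 ∧ W = 0) ∧ (∀ H ∈ a, ⁅H, U⁆ = -(b H • W)) ∧
      ∀ H ∈ a, ⁅H, W⁆ = b H • U := by
  let re : ℂ ⊗[ℝ] L →ₗ[ℝ] L := TensorProduct.lift (LinearMap.lsmul ℝ L ∘ₗ Complex.reLm)
  let im : ℂ ⊗[ℝ] L →ₗ[ℝ] L := TensorProduct.lift (LinearMap.lsmul ℝ L ∘ₗ Complex.imLm)
  have hre : ∀ z v, re (z ⊗ₜ v) = z.re • v := fun z v => rfl
  have him : ∀ z v, im (z ⊗ₜ v) = z.im • v := fun z v => rfl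
  have hdec : ∀ X, X = (1 : ℂ) ⊗ₜ[ℝ] re X + Complex.I ⊗ₜ[ℝ] im X := by
    intro X
    induction X with
    | zero => simp
    | tmul z v =>
      rw [hre, him, ← TensorProduct.smul_tmul, ← TensorProduct.smul_tmul, ← TensorProduct.add_tmul]
      congr 1
      apply Complex.ext <;> simp
    | add x y hx hy =>
      rw [map_add, map_add, TensorProduct.tmul_add, TensorProduct.tmul_add]
      nth_rewrite 1 [hx, hy]
      abel
  -- Bracketing with the real element 1 ⊗ H preserves real and imaginary parts.
  have hbr : ∀ (H : L) (X : ℂ ⊗[ℝ] L), re ⁅(1 : ℂ) ⊗ₜ[ℝ] H, X⁆ = ⁅H, re X⁆ ∧ im ⁅(1 : ℂ) ⊗ₜ[ℝ] H, X⁆ = ⁅H, im X⁆ := by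
    intro H X
    induction X with
    | zero =>
      have e : ⁅(1 : ℂ) ⊗ₜ[ℝ] H, (0 : ℂ ⊗[ℝ] L)⁆ = 0 :=
        lie_zero (L := ℂ ⊗[ℝ] L) (M := ℂ ⊗[ℝ] L) _
      simp [e]
    | tmul z v =>
      rw [LieAlgebra.ExtendScalars.bracket_tmul, hre, him, hre, him, one_mul, lie_smul, lie_smul]
      exact ⟨rfl, rfl⟩
    | add x y hx hy =>
      have e : ⁅(1 : ℂ) ⊗ₜ[ℝ] H, x + y⁆ = ⁅(1 : ℂ) ⊗ₜ[ℝ] H, x⁆ + ⁅(1 : ℂ) ⊗ₜ[ℝ] H, y⁆ :=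
        lie_add (L := ℂ ⊗[ℝ] L) (M := ℂ ⊗[ℝ] L) _ _ _
      rw [e, map_add, map_add, map_add, map_add, hx.1, hx.2, hy.1, hy.2, lie_add, lie_add]
      exact ⟨rfl, rfl⟩
  have hsm : ∀ (c : ℝ) X, re ((Complex.I * (c : ℂ)) • X) = -(c • im X) ∧
      im ((Complex.I * (c : ℂ)) • X) = c • re X := by
    intro c X
    induction X with
    | zero => simp
    | tmul z v =>
      rw [TensorProduct.smul_tmul', hre, him, hre, him, smul_smul, smul_smul, ← neg_smul]
      constructor <;> congr 1 <;> simp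
    | add x y hx hy =>
      rw [smul_add, map_add, map_add, map_add, map_add, hx.1, hx.2, hy.1, hy.2]
      constructor <;> module
  refine ⟨re X, im X, fun h0 => hX ?_, fun H hH => ?_, fun H hH => ?_⟩
  · rw [hdec X, h0.1, h0.2]; simp
  · rw [← (hbr H X).1, h H hH, (hsm _ X).1]
  · rw [← (hbr H X).2, h H hH, (hsm _ X).2]

end RestrictedRoots

/-! ### The abstract data of a symmetric pair and its restricted root. -/

section SymmetricPairs

set_option linter.unusedSectionVars false

variable {E : Type*} [NormedAddCommGroup E] [NormedSpace ℝ E] [FiniteDimensional ℝ E]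
    {G : Type*} [TopologicalSpace G] [T2Space G] [CompactSpace G]
    [ChartedSpace E G] [Group G] [LieGroup 𝓘(ℝ, E) ∞ G]

theorem Ad_lie (g : G) (X Y : LieAlg E G) :
    Ad g ⁅X, Y⁆ = ⁅(Ad g X : LieAlg E G), (Ad g Y : LieAlg E G)⁆ :=
  diffOne_lie (MulAut.conj g).toMonoidHom (contMDiff_conj_right g) X Y

theorem AdE_adE (g : G) (X Y : E) :
    AdE (E := E) g (adE (E := E) G X Y) =
      adE (E := E) G (AdE (E := E) g X) (AdE (E := E) g Y) :=
  (congrArg (AdE (E := E) g) (adE_apply (E := E) (G := G) X Y)).trans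
    ((Ad_lie (E := E) g X Y).trans
      (adE_apply (E := E) (G := G) (AdE (E := E) g X) (AdE (E := E) g Y)).symm)

theorem diffOne_adE (f : G →* G) (hf : ContMDiff 𝓘(ℝ, E) 𝓘(ℝ, E) ∞ f) (X Y : E) :
    diffOne (E := E) f (adE (E := E) G X Y) =
      adE (E := E) G (diffOne (E := E) f X) (diffOne (E := E) f Y) :=
  (congrArg (diffOne (E := E) f) (adE_apply (E := E) (G := G) X Y)).trans
    ((diffOne_lie (E := E) f hf X Y).trans (adE_apply (E := E) (G := G)
      (diffOne (E := E) f X) (diffOne (E := E) f Y)).symm)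

theorem adE_skew (X Y : E) : adE (E := E) G X Y = -adE (E := E) G Y X :=
  (adE_apply (E := E) (G := G) X Y).trans ((lie_skew (L := LieAlg E G) X Y).symm.trans
    (congrArg (fun W : LieAlg E G => -W) (adE_apply (E := E) (G := G) Y X).symm))

theorem adE_jacobi (X Y Z : LieAlg E G) : adE (E := E) G (adE (E := E) G X Y) Z =
    adE (E := E) G X (adE (E := E) G Y Z) - adE (E := E) G Y (adE (E := E) G X Z) := by
  have h : ∀ X Y Z : LieAlg E G, adE (E := E) G X (adE (E := E) G Y Z) =
      (⁅X, (⁅Y, Z⁆ : LieAlg E G)⁆ : LieAlg E G) := fun X Y Z =>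
    (congrArg (adE (E := E) G X) (adE_apply (E := E) (G := G) Y Z)).trans
      (adE_apply (E := E) (G := G) _ _)
  have h' : adE (E := E) G (adE (E := E) G X Y) Z =
      (⁅(⁅X, Y⁆ : LieAlg E G), Z⁆ : LieAlg E G) :=
    (congrArg (fun W => adE (E := E) G W Z) (adE_apply (E := E) (G := G) X Y)).trans
      (adE_apply (E := E) (G := G) _ _)
  exact h'.trans ((lie_lie (L := LieAlg E G) X Y Z).trans
    (congrArg₂ (fun U W : LieAlg E G => U - W) (h X Y Z).symm (h Y X Z).symm))

/-- The isotropy data of an irreducible symmetric pair. -/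
def isotropyData {θ : G →* G} {K : Subgroup G} (hGK : IsSymmetricPair E θ K)
    (hirr : IsIrreduciblePair E θ K) {B : LinearMap.BilinForm ℝ (LieAlg E G)}
    (hB : IsInvariantInnerProduct θ B) : IsotropyData G (LieAlg E G) where
  Ad := Ad
  ad := adE (E := E) G
  T := diffOne θ
  K := K
  B := B
  Ad_one := Ad_one
  Ad_mul := Ad_mul
  continuous_Ad := (contMDiff_AdE (E := E) (G := G)).continuous
  isCompact_K := hGK.closed.isCompact
  Ad_ad := AdE_adE (E := E)
  T_ad := diffOne_adE (E := E) θ hGK.smooth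
  T_T X := by
    have h : MDifferentiableAt 𝓘(ℝ, E) 𝓘(ℝ, E) θ (1 : G) := hGK.smooth.mdifferentiableAt (by simp)
    have h1 := diffOne_comp h h (map_one θ)
    rw [hGK.involutive.comp_self] at h1
    have h2 : (diffOne (id : G → G) : LieAlg E G →L[ℝ] LieAlg E G) = ContinuousLinearMap.id ℝ _ :=
      mfderiv_id
    rw [h2] at h1
    exact congrArg (fun L : LieAlg E G →L[ℝ] LieAlg E G => L X) h1.symm
  T_Ad k hk X := by
    have h := diffOne_comp_AdE θ hGK.smooth k
    rw [hGK.le_fixed k hk] at h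
    exact congrArg (fun L : LieAlg E G →L[ℝ] LieAlg E G => L X) h
  exists_Ad_eq_exp Z hZ := exists_AdE_eq_exp hGK hZ
  ad_skew := adE_skew (E := E) (G := G)
  jacobi := adE_jacobi (E := E) (G := G)
  B_symm := hB.symm
  B_pos := hB.pos
  B_Ad := hB.ad_invariant
  B_ad := bilin_lie_of_invariant (E := E) (G := G) hB.ad_invariant
  irreducible W hW hWK := by
    rcases hirr.2 W hW hWK with h | h
    · exact Or.inl h
    · exact Or.inr fun X hX => h ▸ hX

theorem exists_rootData {θ : G →* G} {K : Subgroup G} (hGK : IsSymmetricPair E θ K)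
    (hirr : IsIrreduciblePair E θ K) {B : LinearMap.BilinForm ℝ (LieAlg E G)}
    (hB : IsInvariantInnerProduct θ B) {a : Submodule ℝ (LieAlg E G)}
    (ha : IsMaximalAbelian θ a) {α : LieAlg E G} (hα : IsRestrictedRoot B a α) :
    ∃ R : RootData (isotropyData hGK hirr hB), R.a = a ∧ R.α = α := by
  obtain ⟨hαa, hα0, X, hX, hroot⟩ := hα
  obtain ⟨U, W, hne, hU, hW⟩ := exists_re_im_of_root_vector (b := fun H => B α H) hX hroot
  have hT : ∀ H ∈ a, diffOne θ H = -H := fun H hH => ha.prop.1 hH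
  obtain ⟨Z, Y, hZ, hY, hTZ, hTY, hadZ, hadY⟩ := (isotropyData hGK hirr hB).exists_root_vector
    (a := a) (α := α) (U := U) (W := W) hT hαa hα0 hne
    (fun H hH => (adE_apply (E := E) (G := G) H U).trans (hU H hH))
    (fun H hH => (adE_apply (E := E) (G := G) H W).trans (hW H hH))
  refine ⟨⟨a, α, Z, Y, hT, fun H hH H' hH' =>
    (adE_apply (E := E) (G := G) H H').trans (ha.prop.2 H hH H' hH'), fun X hX hc => ?_, hαa, hα0,
    hZ, hY, hTZ, hTY, hadZ, hadY⟩, rfl, rfl⟩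
  have hc' : ∀ H ∈ a, (⁅H, X⁆ : LieAlg E G) = 0 := fun H hH =>
    (adE_apply (E := E) (G := G) H X).symm.trans (hc H hH)
  have hle : a ≤ a ⊔ Submodule.span ℝ {X} := le_sup_left
  -- Adjoining to 𝔞 an element of 𝔪 that commutes with it keeps the subspace Abelian, so maximality
  -- already contains that element.
  refine ha.le_of_ge (y := a ⊔ Submodule.span ℝ {X}) ⟨?_, ?_⟩ hle
    (Submodule.mem_sup_right (Submodule.mem_span_singleton_self X))
  · exact sup_le ha.prop.1 (by rw [Submodule.span_singleton_le_iff_mem]; exact hX)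
  · intro P hP Q hQ
    obtain ⟨H, hH, P', hP', rfl⟩ := Submodule.mem_sup.1 hP
    obtain ⟨H', hH', Q', hQ', rfl⟩ := Submodule.mem_sup.1 hQ
    obtain ⟨r, rfl⟩ := Submodule.mem_span_singleton.1 hP'
    obtain ⟨s, rfl⟩ := Submodule.mem_span_singleton.1 hQ'
    have h1 : (⁅X, H'⁆ : LieAlg E G) = 0 := by rw [← lie_skew, hc' H' hH', neg_zero]
    rw [lie_add, add_lie, add_lie, ha.prop.2 H hH H' hH', lie_smul, lie_smul, smul_lie, smul_lie,
      hc' H hH, h1, lie_self]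
    simp

end SymmetricPairs

end SRep

end

/-! ### The theorem for the symmetric pair. -/

theorem mainTheorem7 {E : Type*} [NormedAddCommGroup E] [NormedSpace ℝ E] [FiniteDimensional ℝ E]
    {G : Type*} [TopologicalSpace G] [T2Space G] [CompactSpace G] [ConnectedSpace G]
    [ChartedSpace E G] [Group G] [LieGroup 𝓘(ℝ, E) ∞ G]
    (θ : G →* G) (K : Subgroup G) (hGK : SRep.IsSymmetricPair E θ K)
    (hirr : SRep.IsIrreduciblePair E θ K)
    (B : LinearMap.BilinForm ℝ (SRep.LieAlg E G)) (hB : SRep.IsInvariantInnerProduct θ B)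
    (a : Submodule ℝ (SRep.LieAlg E G)) (ha : SRep.IsMaximalAbelian θ a)
    (α : SRep.LieAlg E G) (hα : SRep.IsRestrictedRoot B a α) :
    SRep.IsWeaklyReflective B (SRep.hypersphere θ B α) (SRep.orbit K α) ∧
    (∃ k₀ ∈ SRep.normalizerIn K a, ∀ X ∈ a, SRep.Ad k₀ X = SRep.rootReflection B α X) ∧
    ∀ k₀ ∈ SRep.normalizerIn K a, (∀ X ∈ a, SRep.Ad k₀ X = SRep.rootReflection B α X) →
      ∃ (p : SRep.hypersphere θ B α) (σ : Equiv.Perm (SRep.hypersphere θ B α)),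
        (p : SRep.LieAlg E G) = α ∧
        (∀ x, (σ x : SRep.LieAlg E G) = -SRep.Ad k₀ (x : SRep.LieAlg E G)) ∧
        (∀ ξ ∈ a, B α ξ = 0 →
          ξ ∈ SRep.normalVectors B (SRep.hypersphere θ B α) (SRep.orbit K α) α ∧
          SRep.IsReflection B (SRep.orbit K α) p ξ σ) ∧
        ∀ ξ ∈ SRep.normalVectors B (SRep.hypersphere θ B α) (SRep.orbit K α) α,
          ∃ k₁ ∈ K, SRep.Ad k₁ α = α ∧ SRep.Ad k₁ ξ ∈ a ∧
            ∃ τ : Equiv.Perm (SRep.hypersphere θ B α),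
              (∀ x, (τ x : SRep.LieAlg E G) =
                SRep.Ad k₁⁻¹ (-SRep.Ad k₀ (SRep.Ad k₁ (x : SRep.LieAlg E G)))) ∧
              SRep.IsReflection B (SRep.orbit K α) p ξ τ := by
  obtain ⟨R, rfl, rfl⟩ := SRep.exists_rootData hGK hirr hB ha hα
  obtain ⟨k, hkK, hk⟩ := R.exists_Ad_eq_reflection
  -- The half turn settles weak reflectivity and existence; the last claim uses only that the given
  -- k₀ lies in K and induces s_α.
  exact ⟨R.isWeaklyReflective_orbit hk hkK, ⟨k, ⟨hkK, R.image_of_reflection hk⟩, hk⟩,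
    fun k₀ hk₀ hrefl => R.exists_reflection hrefl hk₀.1⟩
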